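/- A subgroup $\Gamma\subset \mathrm{PSL}_2(\mathbb C)$ acts discontinuously at $z\in\mathbb P^1=\mathbb P^1(\mathbb C)$ if there is a neighbourhood $W$ of $z$ with $\gamma(W)\cap W=\emptyset$ for all but finitely many $\gamma\in\Gamma$. The set of such points is the set of discontinuity $\Omega_{\mathbb P^1}$, and $\Lambda_{\mathbb P^1}=\mathbb P^1\setminus\Omega_{\mathbb P^1}$ is the limit set of $\Gamma$. The group $\Gamma$ is called Kleinian if $\Omega_{\mathbb P^1}\neq\emptyset$. Let $\tau:\mathbb P^1\to\mathbb P^3$, $\tau([s:t])=[s^3:s^2t:st^2:t^3]$, be the twisted cubic, and let $\tau_*:\mathrm{PSL}_2(\mathbb C)\to\mathrm{PGL}_4(\mathbb C)$ be the homomorphism determined by $\tau\circ g=\tau_*(g)\circ\tau$. Explicitly, $\tau_*$ sends the class of $\begin{pmatrix}a&b\\c&d\end{pmatrix}$ to the class of $$\begin{pmatrix}a^3&3a^2b&3ab^2&b^3\\ a^2c&a^2d+2abc&2abd+b^2c&b^2d\\ ac^2&2acd+bc^2&ad^2+2bcd&bd^2\\ c^3&3c^2d&3cd^2&d^3\end{pmatrix}.$$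 For $p=[s:t]\in\mathbb P^1$ let $\ell_p\subset\mathbb P^3$ be the tangent line to the twisted cubic at $\tau(p)$, i.e. the line spanned by $[3s^2:2st:t^2:0]$ and $[0:s^2:2st:3t^2]$. For a subgroup $G\subset \mathrm{PGL}_4(\mathbb C)$ define a limit set $\Lambda(G)\subset\mathbb P^3$ as follows. A sequence $(\sigma_\nu)$ of pairwise distinct elements of $\mathrm{PGL}_k(\mathbb C)$ is normal if the $\sigma_\nu$ have matrix representatives whose entries have maximal modulus $1$ and which converge to a matrix $S$; its limit image is the projective subspace $\mathbb P(\operatorname{Im} S)\subset\mathbb P^{k-1}$ (independent of the choice of representatives). Let $\rho:\mathrm{PGL}_4(\mathbb C)\to\mathrm{PGL}_6(\mathbb C)$ be induced by $A\mapsto\Lambda^2A$, and embed the set of lines of $\mathbb P^3$ in $\mathbb P^5=\mathbb P(\Lambda^2\mathbb C^4)$ by Plücker coordinates. A line $\ell\subset\mathbb P^3$ is a limit line of $G$ if there is a sequence $(\sigma_\nu)$ in $G$ such that $(\sigma_\nu)$ and $(\rho(\sigma_\nu))$ are both normal and the Plücker point of $\ell$ lies in the limit image of $(\rho(\sigma_\nu))$.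 Then $\Lambda(G)$ is the union of all limit lines of $G$. The group $G$ is of type $\mathbf L$ if it is a discrete subgroup of $\mathrm{PGL}_4(\mathbb C)$ and $\mathbb P^3\setminus\Lambda(G)$ contains a connected open set which contains a projective line. **Theorem.** Let $\Gamma\subset\mathrm{PSL}_2(\mathbb C)$ be a Kleinian group. Then $\tilde\Gamma=\tau_*(\Gamma)\subset\mathrm{PGL}_4(\mathbb C)$ is a group of type $\mathbf L$, and its limit set is $$\Lambda(\tilde\Gamma)=\bigcup_{p\in\Lambda_{\mathbb P^1}}\ell_p .$$ -/

import Mathlib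

open scoped LinearAlgebra.Projectivization Topology

noncomputable section

namespace TypeL

/-! ### Topologies -/

/-- Complex projective space carries the quotient topology of the space of nonzero vectors. -/
instance projectiveTopology (d : ℕ) : TopologicalSpace (ℙ ℂ (Fin d → ℂ)) :=
  TopologicalSpace.coinduced (Projectivization.mk' ℂ) inferInstance

/-- `PGL` carries the quotient topology of `GL`. -/
instance pglTopology (d : ℕ) : TopologicalSpace (Matrix.ProjGenLinGroup (Fin d) ℂ) :=
  TopologicalSpace.coinduced Matrix.ProjGenLinGroup.mk inferInstance

/-! ### Kleinian groups -/

/-- The set of discontinuity of a subgroup of `PSL₂(ℂ)`: the points `z` of the projective line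
having a neighbourhood `W` with `γ(W) ∩ W = ∅` for all but finitely many `γ ∈ Γ`. -/
def discontinuitySet (Γ : Subgroup (Matrix.ProjectiveSpecialLinearGroup (Fin 2) ℂ)) :
    Set (ℙ ℂ (Fin 2 → ℂ)) :=
  {z | ∃ W ∈ 𝓝 z, {γ | γ ∈ Γ ∧ ((fun x => γ • x) '' W ∩ W).Nonempty}.Finite}

/-- A Kleinian group acts discontinuously at some point of the projective line. -/
def IsKleinian (Γ : Subgroup (Matrix.ProjectiveSpecialLinearGroup (Fin 2) ℂ)) : Prop :=
  (discontinuitySet Γ).Nonempty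

/-- The limit set of a Kleinian group, the complement of its set of discontinuity. -/
def kleinianLimitSet (Γ : Subgroup (Matrix.ProjectiveSpecialLinearGroup (Fin 2) ℂ)) :
    Set (ℙ ℂ (Fin 2 → ℂ)) :=
  (discontinuitySet Γ)ᶜ

/-! ### The representation on `m`-vectors -/

/-- The increasing enumeration `k₁ < ⋯ < k_m` of a multi-index `K ⊆ {0, …, d - 1}` of
cardinality `m`. -/
abbrev enum {d m : ℕ} (K : Set.powersetCard (Fin d) m) : Fin m → Fin d :=
  Set.powersetCard.ofFinEmbEquiv.symm K

/-- The matrix of `Λᵐ A` in the standard basis of `Λᵐ ℂᵈ`; its entries are the `m × m` minors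
of `A`. -/
def minors (d m : ℕ) (A : Matrix (Fin d) (Fin d) ℂ) :
    Matrix (Set.powersetCard (Fin d) m) (Set.powersetCard (Fin d) m) ℂ :=
  Matrix.of fun K J => (A.submatrix (enum K) (enum J)).det

theorem minors_eq_toMatrix (d m : ℕ) (A : Matrix (Fin d) (Fin d) ℂ) :
    minors d m A = LinearMap.toMatrix ((Pi.basisFun ℂ (Fin d)).exteriorPower m)
      ((Pi.basisFun ℂ (Fin d)).exteriorPower m) (exteriorPower.map m (Matrix.toLin' A)) := by
  ext K J
  rw [LinearMap.toMatrix_apply, exteriorPower.basis_apply, exteriorPower.map_apply_ιMulti_family,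
    exteriorPower.basis_repr_apply, exteriorPower.ιMulti_family,
    exteriorPower.ιMultiDual_apply_ιMulti, minors, Matrix.of_apply, ← Matrix.det_transpose]
  congr 1
  ext i j
  simp [Matrix.toLin'_apply, enum]

/-- `A ↦ Λᵐ A` is multiplicative. -/
def minorsHom (d m : ℕ) : Matrix (Fin d) (Fin d) ℂ →*
    Matrix (Set.powersetCard (Fin d) m) (Set.powersetCard (Fin d) m) ℂ where
  toFun := minors d m
  map_one' := by
    rw [minors_eq_toMatrix, Matrix.toLin'_one, exteriorPower.map_id, LinearMap.toMatrix_id]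
  map_mul' A B := by
    rw [minors_eq_toMatrix, minors_eq_toMatrix, minors_eq_toMatrix, Matrix.toLin'_mul,
      exteriorPower.map_comp, LinearMap.toMatrix_comp _ ((Pi.basisFun ℂ (Fin d)).exteriorPower m)]

/-- The representation `ρ : PGL_d(ℂ) → PGL_{N+1}(ℂ)`, `N + 1 = d.choose m`, induced by
`A ↦ Λᵐ A`. -/
def rho (d m : ℕ) : Matrix.ProjGenLinGroup (Fin d) ℂ →*
    Matrix.ProjGenLinGroup (Set.powersetCard (Fin d) m) ℂ :=
  Matrix.ProjGenLinGroup.lift (Matrix.ProjGenLinGroup.mk.comp (Units.map (minorsHom d m))) <| by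
    ext u
    rw [MonoidHom.comp_apply, MonoidHom.comp_apply, MonoidHom.one_apply]
    rw [← Matrix.ProjGenLinGroup.mk_scalar (n := Set.powersetCard (Fin d) m) (u ^ m)]
    congr 1
    ext K J
    have h1 : (minors d m 1) K J = (1 : Matrix _ _ ℂ) K J := by
      rw [show minors d m 1 = 1 from (minorsHom d m).map_one]
    have h2 : ((Matrix.GeneralLinearGroup.scalar (Fin d) u : GL (Fin d) ℂ) :
        Matrix (Fin d) (Fin d) ℂ) = (u : ℂ) • 1 := by
      ext i j
      rw [Matrix.GeneralLinearGroup.coe_scalar]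
      simp [Matrix.one_apply, Matrix.diagonal_apply]
    change minors d m _ K J = _
    rw [h2]
    simp only [minors, Matrix.of_apply, Matrix.submatrix_smul] at h1 ⊢
    simp only [Pi.smul_apply, Matrix.det_smul, Fintype.card_fin, h1]
    rw [Matrix.GeneralLinearGroup.coe_scalar]
    simp [Matrix.one_apply, Matrix.diagonal_apply]

/-! ### Normal sequences -/

/-- `S` is the limit of representatives `A ν` of `σ ν` which are normalized so that the largest
modulus of an entry is `1` (the norm of the iterated product space is this maximum). -/
def IsLimitMatrix {ι : Type} [Fintype ι] [DecidableEq ι]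
    (σ : ℕ → Matrix.ProjGenLinGroup ι ℂ) (S : Matrix ι ι ℂ) : Prop :=
  ∃ A : ℕ → GL ι ℂ, (∀ ν, Matrix.ProjGenLinGroup.mk (A ν) = σ ν) ∧
    (∀ ν, ‖(fun i j => (A ν : Matrix ι ι ℂ) i j : ι → ι → ℂ)‖ = 1) ∧
    Filter.Tendsto (fun ν => (A ν : Matrix ι ι ℂ)) Filter.atTop (𝓝 S)

/-- A sequence of distinct elements having convergent normalized representatives. -/
def IsNormalSeq {ι : Type} [Fintype ι] [DecidableEq ι]
    (σ : ℕ → Matrix.ProjGenLinGroup ι ℂ) : Prop :=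
  Function.Injective σ ∧ ∃ S, IsLimitMatrix σ S

/-- `w` lies in the linear subspace whose projectivization is the limit image of `σ`, that is,
in the image of a limit of normalized representatives (the image does not depend on the choice
of representatives). -/
def InLimitImage {ι : Type} [Fintype ι] [DecidableEq ι]
    (σ : ℕ → Matrix.ProjGenLinGroup ι ℂ) (w : ι → ℂ) : Prop :=
  ∃ S, IsLimitMatrix σ S ∧ w ∈ LinearMap.range S.mulVecLin

/-! ### Planes, limit planes, limit sets and groups of type L

A projective `n`-plane is given by a linear subspace of dimension `m = n + 1`.
The ambient projective space is that of `ℂᵈ`, where `d = 2 * m = 2 * n + 2`. -/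

/-- The set of points of the projective linear subspace defined by `ℓ`. -/
def support {d : ℕ} (ℓ : Submodule ℂ (Fin d → ℂ)) : Set (ℙ ℂ (Fin d → ℂ)) :=
  {p | p.submodule ≤ ℓ}

/-- The coordinates of `x₁ ∧ ⋯ ∧ x_m`. -/
def plucker {d m : ℕ} (x : Fin m → Fin d → ℂ) : Set.powersetCard (Fin d) m → ℂ :=
  fun K => (Matrix.of fun i j => x j (enum K i)).det

/-- `w` is a vector of Plücker coordinates of the `m`-dimensional subspace `ℓ`. -/
def IsPlucker {d m : ℕ} (ℓ : Submodule ℂ (Fin d → ℂ))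
    (w : Set.powersetCard (Fin d) m → ℂ) : Prop :=
  ∃ x : Fin m → Fin d → ℂ, LinearIndependent ℂ x ∧ Submodule.span ℂ (Set.range x) = ℓ ∧
    w = plucker x

/-- `ℓ` (of dimension `m`) is a limit plane of `Γ`: there is a sequence `σ` in `Γ`, normal
together with `ρ ∘ σ`, such that the point of the Grassmannian defined by `ℓ` lies in the limit
image of `ρ ∘ σ`. -/
def IsLimitPlane {d : ℕ} (m : ℕ) (Γ : Subgroup (Matrix.ProjGenLinGroup (Fin d) ℂ))
    (ℓ : Submodule ℂ (Fin d → ℂ)) : Prop :=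
  ∃ σ : ℕ → Matrix.ProjGenLinGroup (Fin d) ℂ, (∀ ν, σ ν ∈ Γ) ∧ IsNormalSeq σ ∧
    IsNormalSeq (fun ν => rho d m (σ ν)) ∧
    ∃ w, IsPlucker (m := m) ℓ w ∧ InLimitImage (fun ν => rho d m (σ ν)) w

/-- The limit set: the union of the supports of the limit planes. -/
def limitSet {d : ℕ} (m : ℕ) (Γ : Subgroup (Matrix.ProjGenLinGroup (Fin d) ℂ)) :
    Set (ℙ ℂ (Fin d → ℂ)) :=
  {p | ∃ ℓ, IsLimitPlane m Γ ℓ ∧ p ∈ support ℓ}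

/-- A large domain: a connected open set which contains a plane. -/
def IsLargeDomain {d : ℕ} (m : ℕ) (D : Set (ℙ ℂ (Fin d → ℂ))) : Prop :=
  IsOpen D ∧ IsConnected D ∧
    ∃ ℓ : Submodule ℂ (Fin d → ℂ), Module.finrank ℂ ℓ = m ∧ support ℓ ⊆ D

/-- A group of type L: a discrete subgroup such that the complement of its limit set contains a
large domain. -/
def IsTypeL {d : ℕ} (m : ℕ) (Γ : Subgroup (Matrix.ProjGenLinGroup (Fin d) ℂ)) : Prop :=
  DiscreteTopology Γ ∧ ∃ D : Set (ℙ ℂ (Fin d → ℂ)), IsLargeDomain m D ∧ D ⊆ (limitSet m Γ)ᶜ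

/-! ### The twisted cubic -/

/-- The map `(s, t) ↦ (s³, s²t, st², t³)` of affine cones. -/
def cubicLift (v : Fin 2 → ℂ) : Fin 4 → ℂ :=
  ![v 0 ^ 3, v 0 ^ 2 * v 1, v 0 * v 1 ^ 2, v 1 ^ 3]

theorem cubicLift_ne_zero {v : Fin 2 → ℂ} (hv : v ≠ 0) : cubicLift v ≠ 0 := by
  intro h
  apply hv
  have h0 := congrFun h 0
  have h3 := congrFun h 3
  simp [cubicLift] at h0 h3
  ext i
  fin_cases i <;> simp [h0, h3]

theorem cubicLift_smul (c : ℂ) (v : Fin 2 → ℂ) : cubicLift (c • v) = c ^ 3 • cubicLift v := by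
  ext i
  fin_cases i <;> simp [cubicLift] <;> ring

/-- The parametrization `τ([s : t]) = [s³ : s²t : st² : t³]` of the twisted cubic. -/
def twistedCubic (p : ℙ ℂ (Fin 2 → ℂ)) : ℙ ℂ (Fin 4 → ℂ) :=
  Projectivization.lift
    (fun v : {v : Fin 2 → ℂ // v ≠ 0} =>
      Projectivization.mk ℂ (cubicLift v) (cubicLift_ne_zero v.2))
    (by
      intro a b t h
      rw [Projectivization.mk_eq_mk_iff']
      exact ⟨t ^ 3, by rw [h, cubicLift_smul]⟩) p

/-- The tangent line to the twisted cubic at `τ(p)`: its linear subspace is the image of the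
derivative of the cone map at any representative of `p`. -/
def tangentLine (p : ℙ ℂ (Fin 2 → ℂ)) : Submodule ℂ (Fin 4 → ℂ) :=
  LinearMap.range (fderiv ℂ cubicLift p.rep : (Fin 2 → ℂ) →ₗ[ℂ] (Fin 4 → ℂ))

theorem tangentLine_mk (v : Fin 2 → ℂ) (hv : v ≠ 0) :
    tangentLine (Projectivization.mk ℂ v hv) =
      LinearMap.range (fderiv ℂ cubicLift v : (Fin 2 → ℂ) →ₗ[ℂ] (Fin 4 → ℂ)) := by
  obtain ⟨c, hc⟩ := Projectivization.exists_smul_eq_mk_rep ℂ v hv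
  have hc0 : (c : ℂ) ≠ 0 := c.ne_zero
  have h : (c : ℂ) • fderiv ℂ cubicLift ((c : ℂ) • v) = (c : ℂ) ^ 3 • fderiv ℂ cubicLift v := by
    have e : (fun w => cubicLift ((c : ℂ) • w)) = (c : ℂ) ^ 3 • cubicLift := by
      ext1 w
      exact cubicLift_smul _ _
    rw [← fderiv_comp_smul, e, fderiv_const_smul_field, Pi.smul_apply]
  have h' : fderiv ℂ cubicLift ((c : ℂ) • v) = (c : ℂ) ^ 2 • fderiv ℂ cubicLift v := by
    apply smul_right_injective _ hc0
    simp only [h, smul_smul]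
    congr 1
    ring
  rw [tangentLine, ← hc, Units.smul_def, h', ContinuousLinearMap.toLinearMap_smul,
    LinearMap.range_smul _ _ (pow_ne_zero 2 hc0)]

/-- The matrix of the action of a `2 × 2` matrix on `(s³, s²t, st², t³)`. -/
def cubicMatrix (g : Matrix (Fin 2) (Fin 2) ℂ) : Matrix (Fin 4) (Fin 4) ℂ :=
  let a := g 0 0
  let b := g 0 1
  let c := g 1 0
  let d := g 1 1
  !![a ^ 3, 3 * a ^ 2 * b, 3 * a * b ^ 2, b ^ 3;
    a ^ 2 * c, a ^ 2 * d + 2 * a * b * c, 2 * a * b * d + b ^ 2 * c, b ^ 2 * d;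
    a * c ^ 2, 2 * a * c * d + b * c ^ 2, a * d ^ 2 + 2 * b * c * d, b * d ^ 2;
    c ^ 3, 3 * c ^ 2 * d, 3 * c * d ^ 2, d ^ 3]

theorem cubicMatrix_mulVec (g : Matrix (Fin 2) (Fin 2) ℂ) (v : Fin 2 → ℂ) :
    (cubicMatrix g).mulVec (cubicLift v) = cubicLift (g.mulVec v) := by
  ext i
  fin_cases i <;>
    simp [cubicMatrix, cubicLift, Matrix.mulVec, dotProduct, Fin.sum_univ_succ] <;> ring

/-- `cubicMatrix` is multiplicative. -/
def cubicHom : Matrix (Fin 2) (Fin 2) ℂ →* Matrix (Fin 4) (Fin 4) ℂ where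
  toFun := cubicMatrix
  map_one' := by
    ext i j
    fin_cases i <;> fin_cases j <;> simp [cubicMatrix]
  map_mul' g h := by
    ext i j
    fin_cases i <;> fin_cases j <;>
      simp [cubicMatrix, Matrix.mul_apply, Fin.sum_univ_succ] <;> ring

/-- The representation `τ_* : PSL₂(ℂ) → PGL₄(ℂ)` with `τ ∘ g = τ_*(g) ∘ τ`. -/
def cubicRep : Matrix.ProjectiveSpecialLinearGroup (Fin 2) ℂ →*
    Matrix.ProjGenLinGroup (Fin 4) ℂ :=
  QuotientGroup.lift _
    ((Matrix.ProjGenLinGroup.mk.comp (Units.map cubicHom)).comp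
      Matrix.SpecialLinearGroup.toGL) <| by
    intro g hg
    obtain ⟨r, hr1, hr⟩ := Matrix.SpecialLinearGroup.mem_center_iff.1 hg
    have hr0 : r ≠ 0 := by
      rintro rfl
      simp at hr1
    rw [MonoidHom.mem_ker,
      ← Matrix.ProjGenLinGroup.mk_scalar (n := Fin 4) (Units.mk0 r hr0 ^ 3)]
    change Matrix.ProjGenLinGroup.mk _ = _
    congr 1
    ext i j
    rw [Matrix.GeneralLinearGroup.coe_scalar]
    change cubicMatrix (g : Matrix (Fin 2) (Fin 2) ℂ) i j = _
    rw [← hr]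
    fin_cases i <;> fin_cases j <;> simp [cubicMatrix, pow_succ, mul_assoc]

theorem twistedCubic_smul (g : Matrix.ProjectiveSpecialLinearGroup (Fin 2) ℂ)
    (p : ℙ ℂ (Fin 2 → ℂ)) : twistedCubic (g • p) = cubicRep g • twistedCubic p := by
  induction g using QuotientGroup.induction_on with | H g =>
  induction p with | h v hv =>
  change Projectivization.mk ℂ (cubicLift ((g : Matrix (Fin 2) (Fin 2) ℂ).mulVec v)) _ =
    Projectivization.mk ℂ ((cubicMatrix g).mulVec (cubicLift v)) _
  congr 1
  exact (cubicMatrix_mulVec g v).symm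

end TypeL

end

open scoped LinearAlgebra.Projectivization Topology

noncomputable section

namespace TypeL

/-! ### Minors of the symmetric cube -/

/-! Normalize a sequence of distinct elements of `Γ` and pass to a convergent subsequence. The limit
matrix is singular: if it were invertible, the quotients `g_n⁻¹ g_m` would move a point of
discontinuity arbitrarily little, for infinitely many elements (`exists_attracts`). So the limit has
rank one, say `u vᵀ`; away from the kernel of `v` everything is pushed to `[u]`, which is therefore
a limit point. Conversely, every limit point is such an attracting point
(`exists_attracts_of_mem_kleinianLimitSet`).

The other ingredient is the decomposition of `Λ² Sym³` as `(Sym⁴ ⊗ det) ⊕ det³`. The determinant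
divides all `2 × 2` minors of the symmetric cube, and on `SL₂` it equals 1, so `ρ ∘ τ_*` is given by
a matrix of quartic forms that makes sense at singular matrices. At `u vᵀ` this matrix has rank one,
and its image is the Plücker point of the tangent line at `[u]` (`quarticMatrix_vecMulVec`). Hence
the limit lines are exactly the tangent lines over the limit set of `Γ`.

Discreteness holds because the normalized limits `cubicMatrix (vecMulVec u v)` are singular. The
union of the tangent lines over the closed limit set is closed, and distinct tangent lines are
disjoint. So the tangent line at a point of discontinuity avoids the union, and its component in the
complement is a large domain. -/

/-- The position of the pair `i < j` in the lexicographic order on pairs of elements of `Fin 4`. -/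
def pairIndex (i j : Fin 4) : Fin 6 :=
  (!![0, 0, 1, 2; 0, 0, 3, 4; 0, 0, 0, 5; 0, 0, 0, 0] : Matrix (Fin 4) (Fin 4) (Fin 6)) i j

/-- The `2 × 2` minors of `cubicMatrix g`, divided by `det g`. -/
def quarticMatrix (g : Matrix (Fin 2) (Fin 2) ℂ) : Matrix (Fin 6) (Fin 6) ℂ :=
  let a := g 0 0
  let b := g 0 1
  let c := g 1 0
  let d := g 1 1
  !![a ^ 4, 2 * a ^ 3 * b, a ^ 2 * b ^ 2, 3 * a ^ 2 * b ^ 2, 2 * a * b ^ 3, b ^ 4;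
    2 * a ^ 3 * c, a ^ 3 * d + 3 * a ^ 2 * b * c, a ^ 2 * b * d + a * b ^ 2 * c,
      3 * a ^ 2 * b * d + 3 * a * b ^ 2 * c, 3 * a * b ^ 2 * d + b ^ 3 * c, 2 * b ^ 3 * d;
    3 * a ^ 2 * c ^ 2, 3 * a ^ 2 * c * d + 3 * a * b * c ^ 2,
      a ^ 2 * d ^ 2 + a * b * c * d + b ^ 2 * c ^ 2, 9 * a * b * c * d,
      3 * a * b * d ^ 2 + 3 * b ^ 2 * c * d, 3 * b ^ 2 * d ^ 2;
    a ^ 2 * c ^ 2, a ^ 2 * c * d + a * b * c ^ 2, a * b * c * d,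
      a ^ 2 * d ^ 2 + a * b * c * d + b ^ 2 * c ^ 2, a * b * d ^ 2 + b ^ 2 * c * d, b ^ 2 * d ^ 2;
    2 * a * c ^ 3, 3 * a * c ^ 2 * d + b * c ^ 3, a * c * d ^ 2 + b * c ^ 2 * d,
      3 * a * c * d ^ 2 + 3 * b * c ^ 2 * d, a * d ^ 3 + 3 * b * c * d ^ 2, 2 * b * d ^ 3;
    c ^ 4, 2 * c ^ 3 * d, c ^ 2 * d ^ 2, 3 * c ^ 2 * d ^ 2, 2 * c * d ^ 3, d ^ 4]

/-- The factor `g.det` comes from `Λ² Sym³ = (Sym⁴ ⊗ det) ⊕ det³`. It must be removed before passing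
to a limit: at rank one matrices the minors themselves all vanish. -/
theorem cubicMatrix_minor (g : Matrix (Fin 2) (Fin 2) ℂ) (i j k l : Fin 4) (hij : i < j)
    (hkl : k < l) :
    cubicMatrix g i k * cubicMatrix g j l - cubicMatrix g i l * cubicMatrix g j k =
      g.det * quarticMatrix g (pairIndex i j) (pairIndex k l) := by
  rw [Matrix.det_fin_two]
  fin_cases i <;> fin_cases j <;> first | (exfalso; revert hij; decide) | skip
  all_goals
    fin_cases k <;> fin_cases l <;> first | (exfalso; revert hkl; decide) | skip
  all_goals
    simp [cubicMatrix, quarticMatrix, pairIndex]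
    ring

/-- The Plücker coordinates of the tangent line to the twisted cubic, up to a factor `3`. -/
def tangentPlucker (u : Fin 2 → ℂ) : Fin 6 → ℂ :=
  ![u 0 ^ 4, 2 * u 0 ^ 3 * u 1, 3 * u 0 ^ 2 * u 1 ^ 2, u 0 ^ 2 * u 1 ^ 2, 2 * u 0 * u 1 ^ 3,
    u 1 ^ 4]

/-- The linear form attached to the rank one limit of `quarticMatrix`. -/
def cotangentPlucker (v : Fin 2 → ℂ) : Fin 6 → ℂ :=
  ![v 0 ^ 4, 2 * v 0 ^ 3 * v 1, v 0 ^ 2 * v 1 ^ 2, 3 * v 0 ^ 2 * v 1 ^ 2, 2 * v 0 * v 1 ^ 3,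
    v 1 ^ 4]

/-- After division by `det`, the summands are `Sym⁴` and `det²`. On a rank one matrix the second
vanishes and the first again has rank one, so the limit image will be a single point. -/
theorem quarticMatrix_vecMulVec (u v : Fin 2 → ℂ) :
    quarticMatrix (Matrix.vecMulVec u v) =
      Matrix.vecMulVec (tangentPlucker u) (cotangentPlucker v) := by
  ext i j
  fin_cases i <;> fin_cases j <;>
    simp [quarticMatrix, tangentPlucker, cotangentPlucker, Matrix.vecMulVec_apply] <;> ring

theorem quarticMatrix_smul (c : ℂ) (g : Matrix (Fin 2) (Fin 2) ℂ) :
    quarticMatrix (c • g) = c ^ 4 • quarticMatrix g := by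
  ext i j
  fin_cases i <;> fin_cases j <;> simp [quarticMatrix] <;> ring

theorem cubicMatrix_smul (c : ℂ) (g : Matrix (Fin 2) (Fin 2) ℂ) :
    cubicMatrix (c • g) = c ^ 3 • cubicMatrix g := by
  ext i j
  fin_cases i <;> fin_cases j <;> simp [cubicMatrix] <;> ring

theorem continuous_quarticMatrix : Continuous quarticMatrix := by
  refine continuous_matrix fun i j => ?_
  fin_cases i <;> fin_cases j <;> simp [quarticMatrix] <;> fun_prop

theorem continuous_cubicMatrix : Continuous cubicMatrix := by
  refine continuous_matrix fun i j => ?_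
  fin_cases i <;> fin_cases j <;> simp [cubicMatrix] <;> fun_prop

theorem tangentPlucker_ne_zero {u : Fin 2 → ℂ} (hu : u ≠ 0) :
    tangentPlucker u 0 ≠ 0 ∨ tangentPlucker u 5 ≠ 0 := by
  contrapose! hu
  simp [tangentPlucker] at hu
  ext i
  fin_cases i <;> simp [hu]

theorem cotangentPlucker_ne_zero {u : Fin 2 → ℂ} (hu : u ≠ 0) :
    cotangentPlucker u 0 ≠ 0 ∨ cotangentPlucker u 5 ≠ 0 := by
  contrapose! hu
  simp [cotangentPlucker] at hu
  ext i
  fin_cases i <;> simp [hu]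

theorem enum_lt (K : Set.powersetCard (Fin 4) 2) : enum K 0 < enum K 1 :=
  (Set.powersetCard.ofFinEmbEquiv.symm K).strictMono (by decide)

/-- The index in `Fin 6` of a two-element subset of `Fin 4`. -/
def subsetIndex (K : Set.powersetCard (Fin 4) 2) : Fin 6 := pairIndex (enum K 0) (enum K 1)

theorem exists_enum_eq {i j : Fin 4} (hij : i < j) :
    ∃ K : Set.powersetCard (Fin 4) 2, enum K 0 = i ∧ enum K 1 = j := by
  have h : StrictMono ![i, j] := by
    intro a b hab
    fin_cases a <;> fin_cases b <;> simp_all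
  refine ⟨Set.powersetCard.ofFinEmbEquiv (OrderEmbedding.ofStrictMono _ h), ?_, ?_⟩ <;>
    simp [enum]

/-- `quarticMatrix`, indexed by two-element subsets. -/
def reducedMinors (g : Matrix (Fin 2) (Fin 2) ℂ) :
    Matrix (Set.powersetCard (Fin 4) 2) (Set.powersetCard (Fin 4) 2) ℂ :=
  (quarticMatrix g).submatrix subsetIndex subsetIndex

theorem minors_cubicMatrix (g : Matrix (Fin 2) (Fin 2) ℂ) :
    minors 4 2 (cubicMatrix g) = g.det • reducedMinors g := by
  ext K J
  rw [minors, Matrix.of_apply, Matrix.det_fin_two, Matrix.smul_apply, smul_eq_mul]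
  exact cubicMatrix_minor g _ _ _ _ (enum_lt K) (enum_lt J)

theorem exists_tangentPlucker_ne_zero {u : Fin 2 → ℂ} (hu : u ≠ 0) :
    ∃ K, tangentPlucker u (subsetIndex K) ≠ 0 := by
  obtain h | h := tangentPlucker_ne_zero hu
  · obtain ⟨K, h0, h1⟩ := exists_enum_eq (i := 0) (j := 1) (by decide)
    exact ⟨K, by rwa [subsetIndex, h0, h1]⟩
  · obtain ⟨K, h0, h1⟩ := exists_enum_eq (i := 2) (j := 3) (by decide)
    exact ⟨K, by rwa [subsetIndex, h0, h1]⟩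

theorem exists_cotangentPlucker_ne_zero {u : Fin 2 → ℂ} (hu : u ≠ 0) :
    ∃ K, cotangentPlucker u (subsetIndex K) ≠ 0 := by
  obtain h | h := cotangentPlucker_ne_zero hu
  · obtain ⟨K, h0, h1⟩ := exists_enum_eq (i := 0) (j := 1) (by decide)
    exact ⟨K, by rwa [subsetIndex, h0, h1]⟩
  · obtain ⟨K, h0, h1⟩ := exists_enum_eq (i := 2) (j := 3) (by decide)
    exact ⟨K, by rwa [subsetIndex, h0, h1]⟩

theorem reducedMinors_vecMulVec_ne_zero {u v : Fin 2 → ℂ} (hu : u ≠ 0) (hv : v ≠ 0) :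
    reducedMinors (Matrix.vecMulVec u v) ≠ 0 := by
  obtain ⟨K, hK⟩ := exists_tangentPlucker_ne_zero hu
  obtain ⟨J, hJ⟩ := exists_cotangentPlucker_ne_zero hv
  intro h
  have h' := congrFun (congrFun h K) J
  rw [reducedMinors, quarticMatrix_vecMulVec] at h'
  exact mul_ne_zero hK hJ h'

theorem cubicMatrix_vecMulVec_ne_zero {u v : Fin 2 → ℂ} (hu : u ≠ 0) (hv : v ≠ 0) :
    cubicMatrix (Matrix.vecMulVec u v) ≠ 0 := by
  intro h
  obtain ⟨i, hi⟩ := Function.ne_iff.1 hu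
  obtain ⟨j, hj⟩ := Function.ne_iff.1 hv
  -- Since `u vᵀ` sends this basis vector to `v j • u ≠ 0`, the cube of the basis vector has nonzero
  -- image.
  have h' := cubicMatrix_mulVec (Matrix.vecMulVec u v) (Pi.single j 1)
  rw [h, Matrix.zero_mulVec, Matrix.mulVec_single_one] at h'
  refine cubicLift_ne_zero (fun h0 => ?_) h'.symm
  have := congrFun h0 i
  simp [Matrix.vecMulVec_apply] at this
  exact this.elim hi hj

theorem det_cubicMatrix_vecMulVec (u : Fin 2 → ℂ) {v : Fin 2 → ℂ} (hv : v ≠ 0) :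
    (cubicMatrix (Matrix.vecMulVec u v)).det = 0 := by
  apply Matrix.exists_mulVec_eq_zero_iff.1
  have h0 : ![v 1, -v 0] ≠ 0 := by
    intro h
    apply hv
    have h0 := congrFun h 0
    have h1 := congrFun h 1
    ext i
    fin_cases i <;> simp_all
  -- The vector `![v 1, -v 0]` is killed by the linear form `v`, so its cube is a kernel vector.
  refine ⟨cubicLift ![v 1, -v 0], cubicLift_ne_zero h0, ?_⟩
  rw [cubicMatrix_mulVec]
  ext i
  fin_cases i <;> simp [cubicLift, Matrix.mulVec, dotProduct, Matrix.vecMulVec_apply] <;>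
    ring_nf <;> simp

/-! ### Plücker coordinates of lines -/

/-- The equations say `z ∧ x ∧ y = 0`, expanded along `z`. They involve `x` and `y` only through
Plücker coordinates, and they are closed conditions. -/
theorem mem_span_pair_iff_plucker {x y : Fin 4 → ℂ}
    (h : ∃ j k, x j * y k - x k * y j ≠ 0) (z : Fin 4 → ℂ) :
    z ∈ Submodule.span ℂ {x, y} ↔ ∀ i j k,
      z i * (x j * y k - x k * y j) - z j * (x i * y k - x k * y i) +
        z k * (x i * y j - x j * y i) = 0 := by
  rw [Submodule.mem_span_pair]
  constructor
  · rintro ⟨a, b, rfl⟩ i j k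
    simp only [Pi.add_apply, Pi.smul_apply, smul_eq_mul]
    ring
  · intro hz
    obtain ⟨j, k, hjk⟩ := h
    -- Cramer's rule for the coordinates `j` and `k`, whose minor is nonzero.
    refine ⟨(z j * y k - z k * y j) / (x j * y k - x k * y j),
      (z k * x j - z j * x k) / (x j * y k - x k * y j), ?_⟩
    ext i
    simp only [Pi.add_apply, Pi.smul_apply, smul_eq_mul]
    rw [div_mul_eq_mul_div, div_mul_eq_mul_div, ← add_div, div_eq_iff hjk]
    linear_combination -(hz i j k)

theorem exists_minor_ne_zero {x y : Fin 4 → ℂ} (h : LinearIndependent ℂ ![x, y]) :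
    ∃ j k, x j * y k - x k * y j ≠ 0 := by
  by_contra! hc
  rw [LinearIndependent.pair_iff] at h
  have hx : x ≠ 0 := by
    rintro rfl
    simpa using h 1 0
  obtain ⟨j, hj⟩ := Function.ne_iff.1 hx
  have := h (y j) (-x j) (by
    ext k
    simp only [Pi.add_apply, Pi.smul_apply, smul_eq_mul, Pi.zero_apply]
    linear_combination -(hc j k))
  exact hj (neg_eq_zero.1 this.2)

theorem plucker_apply (x : Fin 2 → Fin 4 → ℂ) (K : Set.powersetCard (Fin 4) 2) :
    plucker x K = x 0 (enum K 0) * x 1 (enum K 1) - x 0 (enum K 1) * x 1 (enum K 0) := by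
  simp [plucker, Matrix.det_fin_two]
  ring

/-- A line is determined by its Plücker coordinates. -/
theorem span_eq_of_plucker_eq_smul {x y : Fin 2 → Fin 4 → ℂ} (hx : LinearIndependent ℂ x)
    (hy : LinearIndependent ℂ y) {c : ℂ} (h : plucker x = c • plucker y) :
    Submodule.span ℂ (Set.range x) = Submodule.span ℂ (Set.range y) := by
  have e : ∀ z : Fin 2 → Fin 4 → ℂ, z = ![z 0, z 1] := fun z => by
    ext i
    fin_cases i <;> rfl
  have key : ∀ i j, x 0 i * x 1 j - x 0 j * x 1 i = c * (y 0 i * y 1 j - y 0 j * y 1 i) := by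
    intro i j
    rcases lt_trichotomy i j with hij | rfl | hij
    · obtain ⟨K, rfl, rfl⟩ := exists_enum_eq hij
      simpa [plucker_apply] using congrFun h K
    · ring
    · obtain ⟨K, rfl, rfl⟩ := exists_enum_eq hij
      have := congrFun h K
      simp only [plucker_apply, Pi.smul_apply, smul_eq_mul] at this
      linear_combination -this
  have hx' : ∃ j k, x 0 j * x 1 k - x 0 k * x 1 j ≠ 0 :=
    exists_minor_ne_zero (by rwa [e x] at hx)
  have hy' : ∃ j k, y 0 j * y 1 k - y 0 k * y 1 j ≠ 0 :=
    exists_minor_ne_zero (by rwa [e y] at hy)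
  -- That `c` is nonzero is not assumed: it follows from the independence of `x`, which has a
  -- nonzero minor.
  have hc : c ≠ 0 := by
    rintro rfl
    obtain ⟨j, k, hjk⟩ := hx'
    exact hjk (by simp [key])
  have r : ∀ z : Fin 2 → Fin 4 → ℂ, Set.range z = {z 0, z 1} := fun z => by
    conv_lhs => rw [e z]
    simp [Matrix.range_cons, Set.pair_comm]
  ext z
  rw [r x, r y, mem_span_pair_iff_plucker hx', mem_span_pair_iff_plucker hy']
  refine forall₃_congr fun i j k => ?_
  rw [key, key, key]
  constructor <;> intro h
  · refine (mul_eq_zero.1 (?_ : c * _ = 0)).resolve_left hc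
    linear_combination h
  · linear_combination c * h

/-! ### Tangent lines -/

/-- The polarization of `cubicLift`. -/
def cubicTangent (u w : Fin 2 → ℂ) : Fin 4 → ℂ :=
  ![3 * u 0 ^ 2 * w 0, 2 * u 0 * u 1 * w 0 + u 0 ^ 2 * w 1,
    u 1 ^ 2 * w 0 + 2 * u 0 * u 1 * w 1, 3 * u 1 ^ 2 * w 1]

theorem fderiv_cubicLift (u w : Fin 2 → ℂ) : fderiv ℂ cubicLift u w = cubicTangent u w := by
  have hd : DifferentiableAt ℂ cubicLift u := by
    rw [differentiableAt_pi]
    intro i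
    fin_cases i <;> simp [cubicLift] <;> fun_prop
  have h1 : HasDerivAt (fun t : ℂ => cubicLift (u + t • w)) (fderiv ℂ cubicLift u w) 0 := by
    have hl : HasDerivAt (fun t : ℂ => u + t • w) w 0 := by
      simpa using ((hasDerivAt_id (0 : ℂ)).smul_const w).const_add u
    have hf : HasFDerivAt cubicLift (fderiv ℂ cubicLift u) (u + (0 : ℂ) • w) := by
      simpa using hd.hasFDerivAt
    exact hf.comp_hasDerivAt 0 hl
  -- Both sides are the derivative at `0` of the curve `t ↦ cubicLift (u + t • w)`; it remains to
  -- differentiate by coordinates.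
  refine h1.unique ?_
  have hl : ∀ i, HasDerivAt (fun t : ℂ => u i + t * w i) (w i) 0 := fun i => by
    simpa using ((hasDerivAt_id (0 : ℂ)).mul_const (w i)).const_add (u i)
  rw [hasDerivAt_pi]
  intro i
  fin_cases i
  · convert! (hl 0).pow 3 using 1
    simp [cubicTangent]
  · convert! ((hl 0).pow 2).mul (hl 1) using 1
    simp [cubicTangent]
    ring
  · convert! (hl 0).mul ((hl 1).pow 2) using 1
    simp [cubicTangent]
    ring
  · convert! (hl 1).pow 3 using 1
    simp [cubicTangent]

theorem mem_tangentLine_mk {u : Fin 2 → ℂ} (hu : u ≠ 0) (z : Fin 4 → ℂ) :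
    z ∈ tangentLine (Projectivization.mk ℂ u hu) ↔ ∃ w, cubicTangent u w = z := by
  rw [tangentLine_mk]
  simp [fderiv_cubicLift]

/-- The standard basis of the tangent line. -/
def tangentBasis (u : Fin 2 → ℂ) : Fin 2 → Fin 4 → ℂ :=
  ![cubicTangent u ![1, 0], cubicTangent u ![0, 1]]

theorem tangentLine_eq_span {u : Fin 2 → ℂ} (hu : u ≠ 0) :
    tangentLine (Projectivization.mk ℂ u hu) =
      Submodule.span ℂ {tangentBasis u 0, tangentBasis u 1} := by
  ext z
  rw [mem_tangentLine_mk, Submodule.mem_span_pair]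
  have h : ∀ a b : ℂ, a • tangentBasis u 0 + b • tangentBasis u 1 = cubicTangent u ![a, b] := by
    intro a b
    ext i
    fin_cases i <;> simp [tangentBasis, cubicTangent] <;> ring
  constructor
  · rintro ⟨w, rfl⟩
    refine ⟨w 0, w 1, ?_⟩
    rw [h]
    congr 1
    ext i
    fin_cases i <;> rfl
  · rintro ⟨a, b, rfl⟩
    exact ⟨_, (h a b).symm⟩

theorem plucker_tangentBasis (u : Fin 2 → ℂ) (K : Set.powersetCard (Fin 4) 2) :
    plucker (tangentBasis u) K = 3 * tangentPlucker u (subsetIndex K) := by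
  rw [plucker_apply, subsetIndex]
  have hK := enum_lt K
  generalize enum K 0 = i at *
  generalize enum K 1 = j at *
  fin_cases i <;> fin_cases j <;> first | (exfalso; revert hK; decide) | skip
  all_goals
    simp [tangentBasis, cubicTangent, tangentPlucker, pairIndex]
    try ring

theorem tangentBasis_minor_ne_zero {u : Fin 2 → ℂ} (hu : u ≠ 0) :
    ∃ j k, tangentBasis u 0 j * tangentBasis u 1 k - tangentBasis u 0 k * tangentBasis u 1 j
      ≠ 0 := by
  obtain h | h := tangentPlucker_ne_zero hu
  · refine ⟨0, 1, ?_⟩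
    simpa [tangentBasis, cubicTangent, tangentPlucker] using h
  · refine ⟨2, 3, ?_⟩
    simpa [tangentBasis, cubicTangent, tangentPlucker] using h

theorem linearIndependent_tangentBasis {u : Fin 2 → ℂ} (hu : u ≠ 0) :
    LinearIndependent ℂ (tangentBasis u) := by
  obtain ⟨j, k, h⟩ := tangentBasis_minor_ne_zero hu
  rw [show tangentBasis u = ![tangentBasis u 0, tangentBasis u 1] from rfl,
    LinearIndependent.pair_iff]
  intro s t hst
  have hj := congrFun hst j
  have hk := congrFun hst k
  simp only [Pi.add_apply, Pi.smul_apply, smul_eq_mul, Pi.zero_apply] at hj hk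
  constructor
  · refine (mul_eq_zero.1 (?_ : s * _ = 0)).resolve_right h
    linear_combination tangentBasis u 1 k * hj - tangentBasis u 1 j * hk
  · refine (mul_eq_zero.1 (?_ : t * _ = 0)).resolve_right h
    linear_combination tangentBasis u 0 j * hk - tangentBasis u 0 k * hj

theorem cubicTangent_ne_zero {u w : Fin 2 → ℂ} (hu : u ≠ 0) (hw : w ≠ 0) :
    cubicTangent u w ≠ 0 := by
  intro h
  have h2 := (LinearIndependent.pair_iff.1 (linearIndependent_tangentBasis hu)) (w 0) (w 1) (by
    rw [← h]
    ext i
    fin_cases i <;> simp [cubicTangent] <;> ring)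
  apply hw
  ext i
  fin_cases i
  exacts [h2.1, h2.2]

theorem finrank_tangentLine (p : ℙ ℂ (Fin 2 → ℂ)) : Module.finrank ℂ (tangentLine p) = 2 := by
  induction p with | h u hu =>
  rw [tangentLine_eq_span, ← Matrix.range_cons_cons_empty _ _ ![]]
  exact (finrank_span_eq_card (linearIndependent_tangentBasis hu)).trans (by simp)

/-- Distinct tangent lines to the twisted cubic are disjoint. -/
theorem cubicTangent_eq_imp {u u' w w' : Fin 2 → ℂ} (h : cubicTangent u w = cubicTangent u' w')
    (hu : u 0 * u' 1 - u 1 * u' 0 ≠ 0) : cubicTangent u w = 0 := by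
  -- Read as a binary cubic in `y`, a point of the tangent line at `u` is divisible by the square of
  -- the linear form vanishing at `u`. A common point of two tangent lines is divisible by two
  -- coprime squares, hence zero by degree.
  have form : ∀ y : Fin 2 → ℂ, (u 0 * y 1 - u 1 * y 0) ^ 2 * (w 0 * y 1 - w 1 * y 0) =
      (u' 0 * y 1 - u' 1 * y 0) ^ 2 * (w' 0 * y 1 - w' 1 * y 0) := by
    intro y
    have h0 := congrFun h 0
    have h1 := congrFun h 1
    have h2 := congrFun h 2
    have h3 := congrFun h 3
    simp [cubicTangent] at h0 h1 h2 h3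
    linear_combination y 1 ^ 3 / 3 * h0 - y 1 ^ 2 * y 0 * h1 + y 1 * y 0 ^ 2 * h2 -
      y 0 ^ 3 / 3 * h3
  set δ := u 0 * u' 1 - u 1 * u' 0 with hδ
  have e1 : w' 0 * u 1 - w' 1 * u 0 = 0 := by
    have := form u
    refine (mul_eq_zero.1 (?_ : δ ^ 2 * _ = 0)).resolve_left (pow_ne_zero 2 hu)
    linear_combination -this
  have e2 : w 0 * u' 1 - w 1 * u' 0 = 0 := by
    have := form u'
    refine (mul_eq_zero.1 (?_ : δ ^ 2 * _ = 0)).resolve_left (pow_ne_zero 2 hu)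
    linear_combination this
  -- At `u ± u'` both squares equal `δ ^ 2`. Adding the two values leaves the linear forms of `w`
  -- and `w'` at `u`, and that of `w'` vanishes there by `e1`.
  have e3 := form (u + u')
  have e4 := form (u - u')
  simp only [Pi.add_apply, Pi.sub_apply] at e3 e4
  have e5 : w 0 * u 1 - w 1 * u 0 = 0 := by
    refine (mul_eq_zero.1 (?_ : δ ^ 2 * _ = 0)).resolve_left (pow_ne_zero 2 hu)
    linear_combination (e3 + e4) / 2 + δ ^ 2 * e1
  have hw0 : w 0 = 0 := by
    refine (mul_eq_zero.1 (?_ : δ * _ = 0)).resolve_left hu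
    rw [hδ]
    linear_combination u 0 * e2 - u' 0 * e5
  have hw1 : w 1 = 0 := by
    refine (mul_eq_zero.1 (?_ : δ * _ = 0)).resolve_left hu
    rw [hδ]
    linear_combination u 1 * e2 - u' 1 * e5
  ext i
  fin_cases i <;> simp [cubicTangent, hw0, hw1]

open Filter

/-! ### Quotient topologies -/

/-- The saturation of an open set is the union of its preimages under all scalings, hence open. -/
theorem isOpenQuotientMap_projMk (d : ℕ) :
    IsOpenQuotientMap (Projectivization.mk' ℂ : {v : Fin d → ℂ // v ≠ 0} → ℙ ℂ (Fin d → ℂ)) := by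
  have hc : Continuous (Projectivization.mk' ℂ : {v : Fin d → ℂ // v ≠ 0} → ℙ ℂ (Fin d → ℂ)) :=
    continuous_coinduced_rng
  refine ⟨fun p => ⟨⟨p.rep, p.rep_nonzero⟩, p.mk_rep⟩, hc, fun U hU => ?_⟩
  have e : Projectivization.mk' ℂ ⁻¹' (Projectivization.mk' ℂ '' U) =
      ⋃ c : ℂˣ, (fun v : {v : Fin d → ℂ // v ≠ 0} =>
        (⟨c • v.1, (smul_ne_zero_iff_ne c).2 v.2⟩ : {v : Fin d → ℂ // v ≠ 0})) ⁻¹' U := by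
    ext v
    simp only [Set.mem_preimage, Set.mem_image, Set.mem_iUnion]
    constructor
    · rintro ⟨w, hw, h⟩
      obtain ⟨c, hc⟩ := (Projectivization.mk_eq_mk_iff ℂ _ _ w.2 v.2).1 h
      exact ⟨c, by simpa only [hc] using hw⟩
    · rintro ⟨c, hc⟩
      exact ⟨_, hc, (Projectivization.mk_eq_mk_iff ℂ _ _ _ v.2).2 ⟨c, rfl⟩⟩
  refine isOpen_coinduced.2 ?_
  rw [e]
  refine isOpen_iUnion fun c => hU.preimage ?_
  exact Continuous.subtype_mk (continuous_subtype_val.const_smul c) _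

theorem exists_nhds_of_mem_nhds_mk {d : ℕ} {u : Fin d → ℂ} {hu : u ≠ 0}
    {W : Set (ℙ ℂ (Fin d → ℂ))} (hW : W ∈ 𝓝 (Projectivization.mk ℂ u hu)) :
    ∃ V ∈ 𝓝 u, ∀ x ∈ V, ∀ hx : x ≠ 0, Projectivization.mk ℂ x hx ∈ W := by
  have h : Projectivization.mk' ℂ ⁻¹' W ∈ 𝓝 (⟨u, hu⟩ : {v : Fin d → ℂ // v ≠ 0}) :=
    (isOpenQuotientMap_projMk d).continuous.continuousAt hW
  obtain ⟨V, hV, hVW⟩ := mem_nhds_subtype _ _ _ |>.1 h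
  exact ⟨V, hV, fun x hx hx0 => hVW (a := ⟨x, hx0⟩) hx⟩

theorem image_mk_mem_nhds {d : ℕ} {u : Fin d → ℂ} (hu : u ≠ 0) {V : Set (Fin d → ℂ)}
    (hV : V ∈ 𝓝 u) : {p | ∃ x ∈ V, ∃ hx : x ≠ 0, Projectivization.mk ℂ x hx = p} ∈
      𝓝 (Projectivization.mk ℂ u hu) := by
  have h : (Subtype.val ⁻¹' V : Set {v : Fin d → ℂ // v ≠ 0}) ∈ 𝓝 ⟨u, hu⟩ :=
    continuous_subtype_val.continuousAt hV
  refine mem_of_superset ((isOpenQuotientMap_projMk d).isOpenMap.image_mem_nhds h) ?_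
  rintro _ ⟨x, hx, rfl⟩
  exact ⟨x, hx, x.2, rfl⟩

/-- Local connectedness descends along an open quotient map. It makes components of open sets open,
as the large domain requires. -/
theorem locallyConnectedSpace_projectivization (d : ℕ) :
    LocallyConnectedSpace (ℙ ℂ (Fin d → ℂ)) := by
  have : LocallyConnectedSpace {v : Fin d → ℂ // v ≠ 0} :=
    (isOpen_compl_singleton (x := (0 : Fin d → ℂ))).locallyConnectedSpace
  have hq := isOpenQuotientMap_projMk d
  rw [locallyConnectedSpace_iff_connected_subsets]
  intro p U hU
  obtain ⟨v, rfl⟩ := hq.surjective p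
  obtain ⟨V, hV, hVc, hVU⟩ := locallyConnectedSpace_iff_connected_subsets.1 this v _
    (hq.continuous.continuousAt hU)
  exact ⟨_, hq.isOpenMap.image_mem_nhds hV, hVc.image _ hq.continuous.continuousOn,
    Set.image_subset_iff.2 hVU⟩

theorem isOpenQuotientMap_pglMk (d : ℕ) :
    IsOpenQuotientMap (Matrix.ProjGenLinGroup.mk : GL (Fin d) ℂ → _) := by
  have hc : Continuous (Matrix.ProjGenLinGroup.mk : GL (Fin d) ℂ → _) := continuous_coinduced_rng
  refine ⟨Matrix.ProjGenLinGroup.mk_surjective, hc, fun U hU => ?_⟩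
  have e : Matrix.ProjGenLinGroup.mk ⁻¹' (Matrix.ProjGenLinGroup.mk '' U) =
      ⋃ c : ℂˣ, (fun A : GL (Fin d) ℂ => A * Matrix.GeneralLinearGroup.scalar (Fin d) c) ⁻¹' U := by
    ext A
    simp only [Set.mem_preimage, Set.mem_image, Set.mem_iUnion]
    constructor
    · rintro ⟨B, hB, h⟩
      obtain ⟨c, rfl⟩ := Matrix.ProjGenLinGroup.mk_eq_mk_iff.1 h.symm
      exact ⟨c, hB⟩
    · rintro ⟨c, hc⟩
      exact ⟨_, hc, by simp⟩
  refine isOpen_coinduced.2 ?_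
  rw [e]
  exact isOpen_iUnion fun c => hU.preimage (continuous_id.mul continuous_const)

/-! ### Proportional matrices -/

/-- Proportionality is expressed by equations between products of entries, which pass to limits and
define closed sets. -/
theorem eq_smul_of_mul_eq_mul {ι : Type*} {A T : Matrix ι ι ℂ} (hT : T ≠ 0)
    (h : ∀ i j k l, A k l * T i j = A i j * T k l) : ∃ c : ℂ, A = c • T := by
  obtain ⟨i, hi⟩ := Function.ne_iff.1 hT
  obtain ⟨j, hj⟩ := Function.ne_iff.1 hi
  refine ⟨A i j / T i j, ?_⟩
  ext k l
  rw [Matrix.smul_apply, smul_eq_mul, div_mul_eq_mul_div, eq_div_iff hj, h]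

section

variable {ι : Type} [Fintype ι] [DecidableEq ι]

theorem pglMk_eq_iff {A B : GL ι ℂ} :
    Matrix.ProjGenLinGroup.mk A = Matrix.ProjGenLinGroup.mk B ↔
      ∃ c : ℂˣ, (B : Matrix ι ι ℂ) = (c : ℂ) • (A : Matrix ι ι ℂ) := by
  rw [Matrix.ProjGenLinGroup.mk_eq_mk_iff]
  refine exists_congr fun c => ?_
  rw [eq_comm, Units.ext_iff]
  have : ((A * Matrix.GeneralLinearGroup.scalar ι c : GL ι ℂ) : Matrix ι ι ℂ) =
      (c : ℂ) • (A : Matrix ι ι ℂ) := by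
    ext i j
    simp [Matrix.GeneralLinearGroup.coe_scalar, mul_comm]
  rw [this]

/-- If multiples of `B ν` converge to `T ≠ 0`, every limit of multiples of the `B ν` is a multiple
of `T`. -/
theorem exists_eq_smul_of_tendsto {A B : ℕ → GL ι ℂ} {d : ℕ → ℂ} {S T : Matrix ι ι ℂ}
    (hmk : ∀ ν, Matrix.ProjGenLinGroup.mk (A ν) = Matrix.ProjGenLinGroup.mk (B ν))
    (hA : Tendsto (fun ν => (A ν : Matrix ι ι ℂ)) atTop (𝓝 S))
    (hB : Tendsto (fun ν => d ν • (B ν : Matrix ι ι ℂ)) atTop (𝓝 T)) (hT : T ≠ 0) :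
    ∃ c : ℂ, S = c • T := by
  -- The proportionality equations hold for every `ν` and survive in the limit, without any control
  -- of the scalars; `c = 0` is not excluded.
  refine eq_smul_of_mul_eq_mul hT fun i j k l => ?_
  have ha : ∀ i j, Tendsto (fun ν => (A ν : Matrix ι ι ℂ) i j) atTop (𝓝 (S i j)) := fun i j =>
    ((continuous_id.matrix_elem i j).tendsto S).comp hA
  have hb : ∀ i j, Tendsto (fun ν => (d ν • (B ν : Matrix ι ι ℂ)) i j) atTop (𝓝 (T i j)) :=
    fun i j => ((continuous_id.matrix_elem i j).tendsto T).comp hB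
  refine tendsto_nhds_unique (((ha k l).mul (hb i j)).congr fun ν => ?_) ((ha i j).mul (hb k l))
  obtain ⟨c, hc⟩ := pglMk_eq_iff.1 (hmk ν)
  simp only [hc, Matrix.smul_apply, smul_eq_mul]
  ring

/-- The norm is continuous and nonzero at `T`, so dividing by it preserves convergence. Any
convenient scaling with nonzero limit can thus replace the normalization by maximal modulus. -/
theorem isLimitMatrix_of_tendsto {σ : ℕ → Matrix.ProjGenLinGroup ι ℂ} {B : ℕ → GL ι ℂ}
    {d : ℕ → ℂ} {T : Matrix ι ι ℂ} (hmk : ∀ ν, Matrix.ProjGenLinGroup.mk (B ν) = σ ν)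
    (hd : ∀ ν, d ν ≠ 0) (hB : Tendsto (fun ν => d ν • (B ν : Matrix ι ι ℂ)) atTop (𝓝 T))
    (hT : T ≠ 0) : ∃ c : ℂ, c ≠ 0 ∧ IsLimitMatrix σ (c • T) := by
  have hne : Nonempty ι := by
    by_contra h
    rw [not_nonempty_iff] at h
    exact hT (Subsingleton.elim _ _)
  let N : Matrix ι ι ℂ → ℝ := fun A => ‖(fun i j => A i j : ι → ι → ℂ)‖
  have hN : Continuous N := by
    refine continuous_norm.comp ?_
    fun_prop
  have hN0 : ∀ A, A ≠ 0 → N A ≠ 0 := fun A hA => norm_ne_zero_iff.2 hA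
  have hs : ∀ (c : ℂ) A, N (c • A) = ‖c‖ * N A := fun c A =>
    norm_smul c (fun i j => A i j : ι → ι → ℂ)
  have hne' : ∀ ν, d ν • (B ν : Matrix ι ι ℂ) ≠ 0 := fun ν =>
    smul_ne_zero (hd ν) (B ν).ne_zero
  let e : ℕ → ℂ := fun ν => ((N (d ν • (B ν : Matrix ι ι ℂ)))⁻¹ : ℝ)
  have he : ∀ ν, e ν ≠ 0 := fun ν =>
    Complex.ofReal_ne_zero.2 (inv_ne_zero (hN0 _ (hne' ν)))
  have hcoe : ∀ ν, ((Matrix.GeneralLinearGroup.scalar ι (Units.mk0 _ (mul_ne_zero (he ν) (hd ν)))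
      * B ν : GL ι ℂ) : Matrix ι ι ℂ) = e ν • d ν • (B ν : Matrix ι ι ℂ) := by
    intro ν
    rw [smul_smul]
    ext i j
    simp [Matrix.GeneralLinearGroup.coe_scalar]
  refine ⟨((N T)⁻¹ : ℝ), Complex.ofReal_ne_zero.2 (inv_ne_zero (hN0 _ hT)),
    fun ν => Matrix.GeneralLinearGroup.scalar ι (Units.mk0 _ (mul_ne_zero (he ν) (hd ν))) * B ν,
    fun ν => by simp [hmk], fun ν => ?_, ?_⟩
  · change N _ = 1
    rw [hcoe, hs, Complex.norm_real, norm_inv, norm_norm]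
    exact inv_mul_cancel₀ (hN0 _ (hne' ν))
  · simp only [hcoe]
    refine Tendsto.smul ?_ hB
    exact (Complex.continuous_ofReal.tendsto _).comp
      (((hN.tendsto T).comp hB).inv₀ (hN0 _ hT))

end

/-! ### Discrete subgroups of `PGL` -/

theorem isClosed_singleton_pgl {d : ℕ} (σ : Matrix.ProjGenLinGroup (Fin d) ℂ) :
    IsClosed {σ} := by
  obtain ⟨A, rfl⟩ := Matrix.ProjGenLinGroup.mk_surjective σ
  rw [← (isOpenQuotientMap_pglMk d).isQuotientMap.isClosed_preimage]
  rcases isEmpty_or_nonempty (Fin d) with hd | hd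
  · have : Subsingleton (GL (Fin d) ℂ) := ⟨fun a b => Units.ext (Subsingleton.elim _ _)⟩
    exact Set.subsingleton_of_subsingleton.isClosed
  have e : Matrix.ProjGenLinGroup.mk ⁻¹' {Matrix.ProjGenLinGroup.mk A} =
      ⋂ i, ⋂ j, ⋂ k, ⋂ l, {B : GL (Fin d) ℂ | (B : Matrix _ _ ℂ) k l * A i j =
        (B : Matrix _ _ ℂ) i j * A k l} := by
    ext B
    simp only [Set.mem_preimage, Set.mem_singleton_iff, Set.mem_iInter, Set.mem_ofPred_eq]
    constructor
    · intro h i j k l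
      obtain ⟨c, hc⟩ := pglMk_eq_iff.1 h.symm
      simp only [hc, Matrix.smul_apply, smul_eq_mul]
      ring
    · intro h
      obtain ⟨c, hc⟩ := eq_smul_of_mul_eq_mul A.ne_zero h
      have hc0 : c ≠ 0 := by
        rintro rfl
        exact B.ne_zero (by rw [hc, zero_smul])
      exact (pglMk_eq_iff.2 ⟨Units.mk0 c hc0, hc⟩).symm
  rw [e]
  have hcont : ∀ i j, Continuous fun B : GL (Fin d) ℂ => (B : Matrix _ _ ℂ) i j := fun i j =>
    (Units.continuous_val (M := Matrix (Fin d) (Fin d) ℂ)).matrix_elem i j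
  exact isClosed_iInter fun i => isClosed_iInter fun j => isClosed_iInter fun k =>
    isClosed_iInter fun l => isClosed_eq ((hcont k l).mul continuous_const)
      ((hcont i j).mul continuous_const)

/-- A subgroup of `PGL` is discrete if it is locally finite. -/
theorem discreteTopology_of_finite {d : ℕ} {G : Subgroup (Matrix.ProjGenLinGroup (Fin d) ℂ)}
    (h : ∀ A : GL (Fin d) ℂ, ∃ V ∈ 𝓝 A,
      {σ | σ ∈ G ∧ ∃ B ∈ V, Matrix.ProjGenLinGroup.mk B = σ}.Finite) : DiscreteTopology G := by
  rw [discreteTopology_iff_isOpen_singleton]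
  rintro ⟨σ, hσ⟩
  obtain ⟨A, rfl⟩ := Matrix.ProjGenLinGroup.mk_surjective σ
  obtain ⟨V, hV, hfin⟩ := h A
  obtain ⟨V', hV', hVo, hAV⟩ := mem_nhds_iff.1 hV
  -- These are the finitely many other elements of `G` near `A`; they form a closed set, and
  -- removing it isolates the class of `A`.
  set F := {σ | σ ∈ G ∧ ∃ B ∈ V, Matrix.ProjGenLinGroup.mk B = σ} \ {Matrix.ProjGenLinGroup.mk A}
    with hF
  have hFc : IsClosed F := by
    rw [← Set.biUnion_of_singleton F]
    exact (hfin.subset Set.sdiff_subset).isClosed_biUnion fun σ _ => isClosed_singleton_pgl σ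
  have ho : IsOpen (Matrix.ProjGenLinGroup.mk '' V' ∩ Fᶜ) :=
    ((isOpenQuotientMap_pglMk d).isOpenMap _ hVo).inter hFc.isOpen_compl
  convert ho.preimage (continuous_subtype_val (p := (· ∈ G)))
  ext ⟨τ, hτ⟩
  simp only [Set.mem_singleton_iff, Subtype.mk.injEq, Set.mem_preimage, Set.mem_inter_iff,
    Set.mem_image, Set.mem_compl_iff]
  constructor
  · rintro rfl
    exact ⟨⟨A, hAV, rfl⟩, fun h => h.2 rfl⟩
  · rintro ⟨⟨B, hB, rfl⟩, hn⟩
    by_contra hne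
    exact hn ⟨⟨hτ, B, hV' hB, rfl⟩, hne⟩

/-! ### Supports -/

theorem mk_mem_support {d : ℕ} {ℓ : Submodule ℂ (Fin d → ℂ)} {x : Fin d → ℂ} (hx : x ≠ 0) :
    Projectivization.mk ℂ x hx ∈ support ℓ ↔ x ∈ ℓ := by
  rw [support, Set.mem_ofPred_eq, Projectivization.submodule_mk, Submodule.span_singleton_le_iff_mem]

/-- The line is the continuous image of `ℂ² ∖ {0}`, which is connected because its real dimension
exceeds 1. -/
theorem isConnected_support_tangentLine (p : ℙ ℂ (Fin 2 → ℂ)) :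
    IsConnected (support (tangentLine p)) := by
  induction p with | h u hu =>
  have hc : IsConnected ({0}ᶜ : Set (Fin 2 → ℂ)) :=
    isConnected_compl_singleton_of_one_lt_rank (by
      rw [← Module.finrank_eq_rank, ← Module.finrank_mul_finrank ℝ ℂ]
      simp) 0
  have hc' : ConnectedSpace {w : Fin 2 → ℂ // w ≠ 0} := isConnected_iff_connectedSpace.1 hc
  let f : {w : Fin 2 → ℂ // w ≠ 0} → ℙ ℂ (Fin 4 → ℂ) := fun w =>
    Projectivization.mk' ℂ ⟨cubicTangent u w, cubicTangent_ne_zero hu w.2⟩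
  have hu' : Continuous (cubicTangent u) := by
    refine continuous_pi fun i => ?_
    fin_cases i <;> simp [cubicTangent] <;> fun_prop
  have hf : Continuous f := (isOpenQuotientMap_projMk 4).continuous.comp
    (Continuous.subtype_mk (hu'.comp continuous_subtype_val) _)
  convert isConnected_range hf
  ext q
  induction q with | h x hx =>
  rw [mk_mem_support, mem_tangentLine_mk]
  constructor
  · rintro ⟨w, rfl⟩
    have hw : w ≠ 0 := by
      rintro rfl
      apply hx
      ext i
      fin_cases i <;> simp [cubicTangent]
    exact ⟨⟨w, hw⟩, rfl⟩
  · rintro ⟨w, hw⟩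
    obtain ⟨c, hc⟩ := (Projectivization.mk_eq_mk_iff' ℂ _ _ hx _).1 hw.symm
    refine ⟨c • w.1, ?_⟩
    rw [← hc]
    ext i
    fin_cases i <;> simp [cubicTangent] <;> ring

theorem projMk_eq_iff {u w : Fin 2 → ℂ} (hu : u ≠ 0) (hw : w ≠ 0) :
    Projectivization.mk ℂ u hu = Projectivization.mk ℂ w hw ↔ u 0 * w 1 - u 1 * w 0 = 0 := by
  rw [Projectivization.mk_eq_mk_iff']
  constructor
  · rintro ⟨c, rfl⟩
    simp only [Pi.smul_apply, smul_eq_mul]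
    ring
  · intro h
    by_cases h0 : w 0 = 0
    · have h1 : w 1 ≠ 0 := fun h1 => hw (by ext i; fin_cases i <;> simp [h0, h1])
      refine ⟨u 1 / w 1, ?_⟩
      have : u 0 = 0 := by simpa [h0, h1] using h
      ext i
      fin_cases i <;> simp [h0, h1, this]
    · refine ⟨u 0 / w 0, ?_⟩
      ext i
      fin_cases i
      · simp [h0]
      · simp
        field_simp
        linear_combination h

theorem disjoint_support_tangentLine {p q : ℙ ℂ (Fin 2 → ℂ)} (h : p ≠ q) :
    Disjoint (support (tangentLine p)) (support (tangentLine q)) := by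
  rw [Set.disjoint_left]
  intro x hp hq
  induction p with | h u hu =>
  induction q with | h v hv =>
  induction x with | h x hx =>
  rw [mk_mem_support, mem_tangentLine_mk] at hp hq
  obtain ⟨w, rfl⟩ := hp
  obtain ⟨w', hw⟩ := hq
  exact hx (cubicTangent_eq_imp hw.symm fun h0 => h ((projMk_eq_iff hu hv).2 h0))

/-- The union of the tangent lines at the points of a closed set is closed. -/
theorem isClosed_biUnion_support_tangentLine {s : Set (ℙ ℂ (Fin 2 → ℂ))} (hs : IsClosed s) :
    IsClosed (⋃ p ∈ s, support (tangentLine p)) := by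
  rw [← (isOpenQuotientMap_projMk 4).isQuotientMap.isClosed_preimage]
  let S := Metric.sphere (0 : Fin 2 → ℂ) 1
  have hS : ∀ u : S, (u : Fin 2 → ℂ) ≠ 0 := fun u => ne_zero_of_mem_unit_sphere u
  let f : S → ℙ ℂ (Fin 2 → ℂ) := fun u => Projectivization.mk' ℂ ⟨u, hS u⟩
  have hf : Continuous f :=
    (isOpenQuotientMap_projMk 2).continuous.comp (Continuous.subtype_mk continuous_subtype_val _)
  -- The incidence relation, with points of `s` represented on the unit sphere. It is closed, and
  -- projection along the compact sphere is a closed map.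
  let C : Set (S × {x : Fin 4 → ℂ // x ≠ 0}) := {y | f y.1 ∈ s ∧ ∀ i j k,
    y.2.1 i * (tangentBasis y.1 0 j * tangentBasis y.1 1 k -
      tangentBasis y.1 0 k * tangentBasis y.1 1 j) -
    y.2.1 j * (tangentBasis y.1 0 i * tangentBasis y.1 1 k -
      tangentBasis y.1 0 k * tangentBasis y.1 1 i) +
    y.2.1 k * (tangentBasis y.1 0 i * tangentBasis y.1 1 j -
      tangentBasis y.1 0 j * tangentBasis y.1 1 i) = 0}
  have hT : ∀ a i, Continuous fun u : Fin 2 → ℂ => tangentBasis u a i := by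
    intro a i
    fin_cases a <;> fin_cases i <;> simp [tangentBasis, cubicTangent] <;> fun_prop
  have hT' : ∀ a i, Continuous fun y : S × {x : Fin 4 → ℂ // x ≠ 0} => tangentBasis y.1 a i :=
    fun a i => (hT a i).comp (continuous_subtype_val.comp continuous_fst)
  have hx' : ∀ i, Continuous fun y : S × {x : Fin 4 → ℂ // x ≠ 0} => y.2.1 i :=
    fun i => (continuous_apply i).comp (continuous_subtype_val.comp continuous_snd)
  have hC : IsClosed C := by
    refine (hs.preimage (hf.comp continuous_fst)).inter ?_
    have e : ∀ P : Fin 4 → Fin 4 → Fin 4 → S × {x : Fin 4 → ℂ // x ≠ 0} → Prop,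
        (∀ i j k, IsClosed {y | P i j k y}) → IsClosed {y | ∀ i j k, P i j k y} := by
      intro P hP
      have : {y | ∀ i j k, P i j k y} = ⋂ i, ⋂ j, ⋂ k, {y | P i j k y} := by
        ext y
        simp
      rw [this]
      exact isClosed_iInter fun i => isClosed_iInter fun j => isClosed_iInter fun k => hP i j k
    refine e _ fun i j k => isClosed_eq ?_ continuous_const
    fun_prop
  convert isClosedMap_snd_of_compactSpace _ hC
  ext x
  simp only [Set.mem_preimage, Set.mem_iUnion, Set.mem_image, Prod.exists, exists_eq_right]
  have key : ∀ u : S, x.1 ∈ tangentLine (f u) ∧ f u ∈ s ↔ (u, x) ∈ C := by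
    intro u
    rw [and_comm]
    refine and_congr_right fun _ => ?_
    change x.1 ∈ tangentLine (Projectivization.mk ℂ _ (hS u)) ↔ _
    rw [tangentLine_eq_span, mem_span_pair_iff_plucker (tangentBasis_minor_ne_zero (hS u))]
  constructor
  · rintro ⟨p, hp, hx⟩
    induction p with | h u hu =>
    have hn : ((‖u‖ : ℂ))⁻¹ ≠ 0 := by simpa using hu
    have hu1 : ((‖u‖ : ℂ))⁻¹ • u ∈ S := by
      simp [S, norm_smul, norm_ne_zero_iff.2 hu]
    have e : f ⟨_, hu1⟩ = Projectivization.mk ℂ u hu :=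
      (Projectivization.mk_eq_mk_iff' ℂ _ _ _ hu).2 ⟨_, rfl⟩
    refine ⟨⟨_, hu1⟩, (key _).1 ?_⟩
    rw [e]
    exact ⟨(mk_mem_support x.2).1 hx, hp⟩
  · rintro ⟨u, hu⟩
    obtain ⟨h1, h2⟩ := (key u).2 hu
    exact ⟨f u, h2, (mk_mem_support x.2).2 h1⟩


open Filter Matrix

/-! ### Convergence properties of Kleinian groups -/

theorem psl_smul_mk (g : SpecialLinearGroup (Fin 2) ℂ) {u : Fin 2 → ℂ} (hu : u ≠ 0) :
    ∃ h : (g : Matrix (Fin 2) (Fin 2) ℂ).mulVec u ≠ 0,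
      (g : ProjectiveSpecialLinearGroup (Fin 2) ℂ) • Projectivization.mk ℂ u hu =
        Projectivization.mk ℂ ((g : Matrix (Fin 2) (Fin 2) ℂ).mulVec u) h :=
  ⟨_, rfl⟩

theorem isClosed_kleinianLimitSet (Γ : Subgroup (ProjectiveSpecialLinearGroup (Fin 2) ℂ)) :
    IsClosed (kleinianLimitSet Γ) := by
  refine IsOpen.isClosed_compl (isOpen_iff_mem_nhds.2 ?_)
  rintro z ⟨W, hW, hfin⟩
  obtain ⟨V, hVW, hV, hz⟩ := mem_nhds_iff.1 hW
  exact mem_of_superset (hV.mem_nhds hz) fun y hy => ⟨W, mem_of_superset (hV.mem_nhds hy) hVW, hfin⟩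

/-- Multiples of the matrices `g ν` converge to the rank one matrix `u vᵀ`. -/
def Attracts (g : ℕ → SpecialLinearGroup (Fin 2) ℂ) (u v : Fin 2 → ℂ) : Prop :=
  ∃ c : ℕ → ℂ, (∀ ν, c ν ≠ 0) ∧
    Tendsto (fun ν => c ν • (g ν : Matrix (Fin 2) (Fin 2) ℂ)) atTop (𝓝 (vecMulVec u v))

theorem exists_eq_vecMulVec {S : Matrix (Fin 2) (Fin 2) ℂ} (hS : S ≠ 0) (hdet : S.det = 0) :
    ∃ u v, u ≠ 0 ∧ v ≠ 0 ∧ S = vecMulVec u v := by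
  rw [det_fin_two] at hdet
  have h : ∃ u v, S = vecMulVec u v := by
    by_cases h0 : S 0 = 0
    · refine ⟨![0, 1], S 1, ?_⟩
      ext i j
      fin_cases i <;> fin_cases j <;> simp [vecMulVec_apply, h0]
    · obtain ⟨j, hj⟩ := Function.ne_iff.1 h0
      refine ⟨![1, S 1 j / S 0 j], S 0, ?_⟩
      ext i k
      fin_cases i
      · simp [vecMulVec_apply]
      · simp only [vecMulVec_apply, Fin.mk_one, cons_val_one, cons_val_fin_one]
        rw [div_mul_eq_mul_div, eq_div_iff hj]
        fin_cases j <;> fin_cases k <;> simp <;>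
          first | linear_combination hdet | linear_combination -hdet
  obtain ⟨u, v, rfl⟩ := h
  refine ⟨u, v, ?_, ?_, rfl⟩ <;> rintro rfl <;> simp at hS

theorem det_smul_eq_adjugate_mulVec (S : Matrix (Fin 2) (Fin 2) ℂ) (w : Fin 2 → ℂ) :
    S.det • w = (adjugate S).mulVec (S.mulVec w) := by
  rw [mulVec_mulVec, adjugate_mul, smul_mulVec, one_mulVec]

theorem continuous_adjugate_mulVec (w : Fin 2 → ℂ) :
    Continuous fun p : Matrix (Fin 2) (Fin 2) ℂ × Matrix (Fin 2) (Fin 2) ℂ =>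
      (adjugate p.1).mulVec (p.2.mulVec w) :=
  continuous_fst.matrix_adjugate.matrix_mulVec (continuous_snd.matrix_mulVec continuous_const)

/-- The adjugate is the inverse up to a scalar. For invertible `S` this says, projectively, that `(h
n)⁻¹ (h m) w` tends to `w` as `n` and `m` grow independently. -/
theorem tendsto_adjugate_mulVec {h : ℕ → Matrix (Fin 2) (Fin 2) ℂ} {S : Matrix (Fin 2) (Fin 2) ℂ}
    (hlim : Tendsto h atTop (𝓝 S)) (w : Fin 2 → ℂ) :
    Tendsto (fun p : ℕ × ℕ => (adjugate (h p.1)).mulVec ((h p.2).mulVec w)) (atTop ×ˢ atTop)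
      (𝓝 (S.det • w)) := by
  rw [det_smul_eq_adjugate_mulVec]
  have h2 : Tendsto (fun p : ℕ × ℕ => (h p.1, h p.2)) (atTop ×ˢ atTop) (𝓝 (S, S)) :=
    Tendsto.prodMk_nhds (hlim.comp tendsto_fst) (hlim.comp tendsto_snd)
  have := ((continuous_adjugate_mulVec w).tendsto (S, S)).comp h2
  exact this

theorem inv_mul_mulVec (g h : SpecialLinearGroup (Fin 2) ℂ) (w : Fin 2 → ℂ) :
    ((g⁻¹ * h : SpecialLinearGroup (Fin 2) ℂ) : Matrix (Fin 2) (Fin 2) ℂ).mulVec w =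
      (adjugate (g : Matrix (Fin 2) (Fin 2) ℂ)).mulVec
        ((h : Matrix (Fin 2) (Fin 2) ℂ).mulVec w) := by
  have e : ((g⁻¹ * h : SpecialLinearGroup (Fin 2) ℂ) : Matrix (Fin 2) (Fin 2) ℂ) =
    adjugate (g : Matrix (Fin 2) (Fin 2) ℂ) * (h : Matrix (Fin 2) (Fin 2) ℂ) := rfl
  rw [e, mulVec_mulVec]

/-- A sequence of distinct elements of a Kleinian group has a subsequence which degenerates. -/
theorem exists_attracts {Γ : Subgroup (ProjectiveSpecialLinearGroup (Fin 2) ℂ)}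
    (hΓ : IsKleinian Γ) {g : ℕ → SpecialLinearGroup (Fin 2) ℂ}
    (hg : ∀ ν, (g ν : ProjectiveSpecialLinearGroup (Fin 2) ℂ) ∈ Γ)
    (hinj : Function.Injective fun ν => (g ν : ProjectiveSpecialLinearGroup (Fin 2) ℂ)) :
    ∃ φ : ℕ → ℕ, StrictMono φ ∧ ∃ u v, u ≠ 0 ∧ v ≠ 0 ∧ Attracts (g ∘ φ) u v := by
  have hg0 : ∀ ν, (fun i j => (g ν : Matrix (Fin 2) (Fin 2) ℂ) i j : Fin 2 → Fin 2 → ℂ) ≠ 0 := by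
    intro ν h
    have h1 := (g ν).2
    have : (g ν : Matrix (Fin 2) (Fin 2) ℂ) = 0 := h
    rw [this] at h1
    simp at h1
  let N : ℕ → ℝ := fun ν => ‖(fun i j => (g ν : Matrix (Fin 2) (Fin 2) ℂ) i j : Fin 2 → Fin 2 → ℂ)‖
  have hN : ∀ ν, N ν ≠ 0 := fun ν => norm_ne_zero_iff.2 (hg0 ν)
  let c : ℕ → ℂ := fun ν => ((N ν)⁻¹ : ℝ)
  have hc : ∀ ν, c ν ≠ 0 := fun ν => Complex.ofReal_ne_zero.2 (inv_ne_zero (hN ν))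
  obtain ⟨S, hS, φ, hφ, hlim⟩ := (isCompact_sphere (0 : Fin 2 → Fin 2 → ℂ) 1).tendsto_subseq
    (x := fun ν => c ν • (fun i j => (g ν : Matrix (Fin 2) (Fin 2) ℂ) i j)) (by
      intro ν
      rw [mem_sphere_zero_iff_norm, norm_smul, Complex.norm_real, norm_inv, norm_norm]
      exact inv_mul_cancel₀ (hN ν))
  have hS0 : Matrix.of S ≠ 0 := by
    intro h
    have : S = 0 := h
    simp [this] at hS
  have hlim' : Tendsto (fun ν => c (φ ν) • (g (φ ν) : Matrix (Fin 2) (Fin 2) ℂ)) atTop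
      (𝓝 (Matrix.of S)) := hlim
  by_cases hdet : (Matrix.of S).det = 0
  · obtain ⟨u, v, hu, hv, e⟩ := exists_eq_vecMulVec hS0 hdet
    exact ⟨φ, hφ, u, v, hu, hv, fun ν => c (φ ν), fun ν => hc _, e ▸ hlim'⟩
  -- With an invertible limit, `(g (φ n))⁻¹ * g (φ (m + k))` keeps a point of discontinuity inside
  -- `W` for one fixed `n` and all `k`: infinitely many elements, against discontinuity.
  exfalso
  obtain ⟨z, W, hW, hfin⟩ := hΓ
  induction z with | h w hw =>
  have hdw : (Matrix.of S).det • w ≠ 0 := smul_ne_zero hdet hw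
  have hz : Projectivization.mk ℂ w hw = Projectivization.mk ℂ _ hdw :=
    ((Projectivization.mk_eq_mk_iff' ℂ _ _ _ _).2 ⟨_, rfl⟩).symm
  obtain ⟨V, hV, hVW⟩ := exists_nhds_of_mem_nhds_mk (hz ▸ hW)
  have hcont : Tendsto (fun p : ℕ × ℕ =>
      (adjugate (c (φ p.1) • (g (φ p.1) : Matrix (Fin 2) (Fin 2) ℂ))).mulVec
        ((c (φ p.2) • (g (φ p.2) : Matrix (Fin 2) (Fin 2) ℂ)).mulVec w)) (atTop ×ˢ atTop)
      (𝓝 ((Matrix.of S).det • w)) := tendsto_adjugate_mulVec hlim' w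
  have hev := hcont.eventually hV
  rw [prod_atTop_atTop_eq, eventually_atTop] at hev
  obtain ⟨⟨n, m⟩, hnm⟩ := hev
  have hmem : ∀ k, (g (φ n) : ProjectiveSpecialLinearGroup (Fin 2) ℂ)⁻¹ * g (φ (m + k)) ∈
      {γ | γ ∈ Γ ∧ ((fun x => γ • x) '' W ∩ W).Nonempty} := by
    intro k
    refine ⟨Γ.mul_mem (Γ.inv_mem (hg _)) (hg _), _, ⟨_, mem_of_mem_nhds hW, rfl⟩, ?_⟩
    have h1 := hnm (n, m + k) ⟨le_rfl, by simp⟩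
    obtain ⟨h2, h3⟩ := psl_smul_mk ((g (φ n))⁻¹ * g (φ (m + k))) hw
    change ((((g (φ n))⁻¹ * g (φ (m + k)) : SpecialLinearGroup (Fin 2) ℂ)) :
      ProjectiveSpecialLinearGroup (Fin 2) ℂ) • _ ∈ W
    rw [h3]
    have e : (adjugate (c (φ n) • (g (φ n) : Matrix (Fin 2) (Fin 2) ℂ))).mulVec
        ((c (φ (m + k)) • (g (φ (m + k)) : Matrix (Fin 2) (Fin 2) ℂ)).mulVec w) =
        (c (φ n) * c (φ (m + k))) •
          (((g (φ n))⁻¹ * g (φ (m + k)) : SpecialLinearGroup (Fin 2) ℂ) :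
            Matrix (Fin 2) (Fin 2) ℂ).mulVec w := by
      rw [inv_mul_mulVec, adjugate_smul, smul_mulVec, smul_mulVec, mulVec_smul, smul_smul]
      simp
    simp only [e] at h1
    have h4 : (c (φ n) * c (φ (m + k))) •
          (((g (φ n))⁻¹ * g (φ (m + k)) : SpecialLinearGroup (Fin 2) ℂ) :
            Matrix (Fin 2) (Fin 2) ℂ).mulVec w ≠ 0 :=
      smul_ne_zero (mul_ne_zero (hc _) (hc _)) h2
    have h5 := hVW _ h1 h4
    rwa [(Projectivization.mk_eq_mk_iff' ℂ _ _ _ h2).2 ⟨_, rfl⟩] at h5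
  refine Set.infinite_of_injective_forall_mem (fun k l hkl => ?_) hmem hfin
  have := hφ.injective (hinj (mul_left_cancel hkl))
  omega

theorem Attracts.tendsto_mulVec {g : ℕ → SpecialLinearGroup (Fin 2) ℂ} {u v : Fin 2 → ℂ}
    (h : Attracts g u v) {x : ℕ → Fin 2 → ℂ} {y : Fin 2 → ℂ} (hx : Tendsto x atTop (𝓝 y)) :
    ∃ c : ℕ → ℂ, (∀ ν, c ν ≠ 0) ∧
      Tendsto (fun ν => c ν • (g ν : Matrix (Fin 2) (Fin 2) ℂ).mulVec (x ν)) atTop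
        (𝓝 ((v ⬝ᵥ y) • u)) := by
  obtain ⟨c, hc, hlim⟩ := h
  refine ⟨c, hc, ?_⟩
  have hF : Continuous fun p : Matrix (Fin 2) (Fin 2) ℂ × (Fin 2 → ℂ) => p.1.mulVec p.2 :=
    continuous_fst.matrix_mulVec continuous_snd
  have := (hF.tendsto (vecMulVec u v, y)).comp (hlim.prodMk_nhds hx)
  have e : (vecMulVec u v).mulVec y = (v ⬝ᵥ y) • u := by
    ext i
    simp [vecMulVec_mulVec, mul_comm]
  rw [e] at this
  exact this.congr fun ν => smul_mulVec _ _ _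

/-- A vector spanning the kernel of the linear form `v`. -/
def perp (v : Fin 2 → ℂ) : Fin 2 → ℂ := ![v 1, -v 0]

theorem perp_ne_zero {v : Fin 2 → ℂ} (hv : v ≠ 0) : perp v ≠ 0 := by
  intro h
  apply hv
  have h0 := congrFun h 0
  have h1 := congrFun h 1
  simp [perp] at h0 h1
  ext i
  fin_cases i <;> simp [h0, h1]

/-- In determinant one the inverse is the adjugate, which is linear for `2 × 2` matrices. The same
scalars therefore work, and the kernel of `v` becomes the attracting point. -/
theorem Attracts.inv {g : ℕ → SpecialLinearGroup (Fin 2) ℂ} {u v : Fin 2 → ℂ}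
    (h : Attracts g u v) : Attracts (fun ν => (g ν)⁻¹) (perp v) (perp u) := by
  obtain ⟨c, hc, hlim⟩ := h
  refine ⟨c, hc, ?_⟩
  have hF : Continuous fun p : Matrix (Fin 2) (Fin 2) ℂ => adjugate p :=
    continuous_id.matrix_adjugate
  have e : adjugate (vecMulVec u v) = vecMulVec (perp v) (perp u) := by
    rw [adjugate_fin_two]
    ext i j
    fin_cases i <;> fin_cases j <;> simp [vecMulVec_apply, perp, mul_comm]
  have := (hF.tendsto (vecMulVec u v)).comp hlim
  rw [e] at this
  refine this.congr fun ν => ?_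
  simp [adjugate_smul]

/-- A vector near `u` and outside the kernel of `v` is carried to points tending to `[u]`, so
infinitely many translates of any neighbourhood of `[u]` meet it. -/
theorem Attracts.mem_kleinianLimitSet {Γ : Subgroup (ProjectiveSpecialLinearGroup (Fin 2) ℂ)}
    {g : ℕ → SpecialLinearGroup (Fin 2) ℂ} {u v : Fin 2 → ℂ} (h : Attracts g u v)
    (hg : ∀ ν, (g ν : ProjectiveSpecialLinearGroup (Fin 2) ℂ) ∈ Γ)
    (hinj : Function.Injective fun ν => (g ν : ProjectiveSpecialLinearGroup (Fin 2) ℂ))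
    (hu : u ≠ 0) (hv : v ≠ 0) : Projectivization.mk ℂ u hu ∈ kleinianLimitSet Γ := by
  rintro ⟨W, hW, hfin⟩
  obtain ⟨V, hV, hVW⟩ := exists_nhds_of_mem_nhds_mk hW
  -- The vector `u` itself may lie in the kernel of `v`; it is then perturbed along a coordinate on
  -- which `v` is nonzero.
  obtain ⟨x, hxV, hx⟩ : ∃ x ∈ V, v ⬝ᵥ x ≠ 0 := by
    by_cases h0 : v ⬝ᵥ u = 0
    · obtain ⟨j, hj⟩ := Function.ne_iff.1 hv
      have hlim : Tendsto (fun n : ℕ => u + ((n + 1 : ℂ))⁻¹ • (Pi.single j 1 : Fin 2 → ℂ)) atTop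
          (𝓝 u) := by
        have h1 : Tendsto (fun n : ℕ => ((n + 1 : ℂ))⁻¹) atTop (𝓝 0) := by
          simpa using tendsto_one_div_add_atTop_nhds_zero_nat (𝕜 := ℂ)
        simpa using (h1.smul_const (Pi.single j 1 : Fin 2 → ℂ)).const_add u
      obtain ⟨n, hn⟩ := (hlim.eventually hV).exists
      refine ⟨_, hn, ?_⟩
      rw [dotProduct_add, h0, zero_add, dotProduct_smul, dotProduct_single_one]
      exact smul_ne_zero (inv_ne_zero (Nat.cast_add_one_ne_zero n)) hj
    · exact ⟨u, mem_of_mem_nhds hV, h0⟩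
  have hx0 : x ≠ 0 := by
    rintro rfl
    simp at hx
  obtain ⟨c, hc, hlim⟩ := h.tendsto_mulVec (x := fun _ => x) tendsto_const_nhds
  have hu' : (v ⬝ᵥ x) • u ≠ 0 := smul_ne_zero hx hu
  have hmk : Projectivization.mk ℂ u hu = Projectivization.mk ℂ _ hu' :=
    ((Projectivization.mk_eq_mk_iff' ℂ _ _ _ _).2 ⟨_, rfl⟩).symm
  obtain ⟨V', hV', hVW'⟩ := exists_nhds_of_mem_nhds_mk (hmk ▸ hW)
  obtain ⟨n, hn⟩ := eventually_atTop.1 (hlim.eventually hV')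
  have hmem : ∀ k, (g (n + k) : ProjectiveSpecialLinearGroup (Fin 2) ℂ) ∈
      {γ | γ ∈ Γ ∧ ((fun x => γ • x) '' W ∩ W).Nonempty} := by
    intro k
    refine ⟨hg _, _, ⟨_, hVW x hxV hx0, rfl⟩, ?_⟩
    obtain ⟨h1, h2⟩ := psl_smul_mk (g (n + k)) hx0
    have h3 := smul_ne_zero (hc (n + k)) h1
    have h4 := hVW' _ (hn (n + k) (by simp)) h3
    simp only [h2]
    rwa [(Projectivization.mk_eq_mk_iff' ℂ _ _ _ h1).2 ⟨_, rfl⟩] at h4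
  refine Set.infinite_of_injective_forall_mem (fun k l hkl => ?_) hmem hfin
  simpa using hinj hkl

/-- A diagonal choice of distinct elements from a decreasing sequence of infinite sets. -/
theorem exists_injective_forall_mem {α : Type*} {s : ℕ → Set α} (hs : Antitone s)
    (hinf : ∀ n, (s n).Infinite) : ∃ f : ℕ → α, Function.Injective f ∧ ∀ n, f n ∈ s n := by
  classical
  -- Each element is chosen together with an index. The indices increase strictly, so the `n`-th is
  -- at least `n`, and antitonicity gives membership in `s n`.
  obtain ⟨f, hf, hlt⟩ := exists_seq_of_forall_finset_exists
    (fun p : ℕ × α => p.2 ∈ s p.1) (fun p q => p.1 < q.1 ∧ p.2 ≠ q.2) (by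
      intro t _
      obtain ⟨a, ha, hat⟩ := (hinf (t.sup Prod.fst + 1)).exists_notMem_finset (t.image Prod.snd)
      refine ⟨(t.sup Prod.fst + 1, a), ha, fun x hx => ⟨?_, ?_⟩⟩
      · exact Nat.lt_succ_of_le (Finset.le_sup (f := Prod.fst) hx)
      · rintro rfl
        exact hat (Finset.mem_image_of_mem _ hx))
  have hmono : StrictMono fun n => (f n).1 := fun m n hmn => (hlt m n hmn).1
  refine ⟨fun n => (f n).2, fun m n hmn => ?_, fun n => hs (hmono.id_le n) (hf n)⟩
  rcases lt_trichotomy m n with h | h | h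
  · exact absurd hmn (hlt m n h).2
  · exact h
  · exact absurd hmn.symm (hlt n m h).2

/-- Shrinking neighbourhoods of `p` give distinct elements of `Γ` carrying points `x n` to points `y
n`, both tending to `p`. Comparing with a rank one limit leaves two cases: `p` is its attracting
point or its kernel. -/
theorem exists_attracts_of_mem_kleinianLimitSet
    {Γ : Subgroup (ProjectiveSpecialLinearGroup (Fin 2) ℂ)} (hΓ : IsKleinian Γ)
    {p : ℙ ℂ (Fin 2 → ℂ)} (hp : p ∈ kleinianLimitSet Γ) :
    ∃ (g : ℕ → SpecialLinearGroup (Fin 2) ℂ) (u v : Fin 2 → ℂ) (hu : u ≠ 0),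
      (∀ ν, (g ν : ProjectiveSpecialLinearGroup (Fin 2) ℂ) ∈ Γ) ∧
      (Function.Injective fun ν => (g ν : ProjectiveSpecialLinearGroup (Fin 2) ℂ)) ∧
      v ≠ 0 ∧ Attracts g u v ∧ Projectivization.mk ℂ u hu = p := by
  induction p with | h w hw =>
  let W : ℕ → Set (ℙ ℂ (Fin 2 → ℂ)) := fun n =>
    {p | ∃ x ∈ Metric.ball w (1 / ((n : ℝ) + 1)), ∃ hx : x ≠ 0, Projectivization.mk ℂ x hx = p}
  have hW : Antitone W := by
    rintro m n hmn _ ⟨x, hx, hx0, rfl⟩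
    exact ⟨x, Metric.ball_subset_ball (Nat.one_div_le_one_div hmn) hx, hx0, rfl⟩
  obtain ⟨γ, hinj, hγ⟩ := exists_injective_forall_mem
    (s := fun n => {γ | γ ∈ Γ ∧ ((fun x => γ • x) '' W n ∩ W n).Nonempty})
    (fun m n hmn γ hγ => ⟨hγ.1, hγ.2.mono
      (Set.inter_subset_inter (Set.image_mono (hW hmn)) (hW hmn))⟩)
    (fun n hfin => hp ⟨W n, image_mk_mem_nhds hw
      (Metric.ball_mem_nhds _ Nat.one_div_pos_of_nat), hfin⟩)
  choose g hg using fun n => QuotientGroup.mk_surjective (γ n)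
  obtain rfl : (fun n => (g n : ProjectiveSpecialLinearGroup (Fin 2) ℂ)) = γ := funext hg
  have hgΓ := fun n => (hγ n).1
  have hxy : ∀ n : ℕ, ∃ x ∈ Metric.ball w (1 / ((n : ℝ) + 1)),
      ∃ y ∈ Metric.ball w (1 / ((n : ℝ) + 1)),
      ((g n : Matrix (Fin 2) (Fin 2) ℂ).mulVec x) 0 * y 1 -
        ((g n : Matrix (Fin 2) (Fin 2) ℂ).mulVec x) 1 * y 0 = 0 := by
    intro n
    obtain ⟨_, ⟨_, ⟨x, hx, hx0, rfl⟩, rfl⟩, ⟨y, hy, hy0, hxy⟩⟩ := (hγ n).2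
    obtain ⟨h1, h2⟩ := psl_smul_mk (g n) hx0
    exact ⟨x, hx, y, hy, (projMk_eq_iff h1 hy0).1 (h2.symm.trans hxy.symm)⟩
  choose x hx y hy hxy using hxy
  have hlim : ∀ x : ℕ → Fin 2 → ℂ, (∀ n : ℕ, x n ∈ Metric.ball w (1 / ((n : ℝ) + 1))) →
      Tendsto x atTop (𝓝 w) := fun x hx => by
    rw [tendsto_iff_dist_tendsto_zero]
    exact squeeze_zero (fun _ => dist_nonneg) (fun n => (hx n).le)
      tendsto_one_div_add_atTop_nhds_zero_nat
  obtain ⟨φ, hφ, u, v, hu, hv, hatt⟩ := exists_attracts hΓ hgΓ hinj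
  obtain ⟨c, hc, hc'⟩ := hatt.tendsto_mulVec ((hlim x hx).comp hφ.tendsto_atTop)
  have hy' := (hlim y hy).comp hφ.tendsto_atTop
  have hcross : (v ⬝ᵥ w) * (u 0 * w 1 - u 1 * w 0) = 0 := by
    have h1 := ((tendsto_pi_nhds.1 hc' 0).mul (tendsto_pi_nhds.1 hy' 1)).sub
      ((tendsto_pi_nhds.1 hc' 1).mul (tendsto_pi_nhds.1 hy' 0))
    have h2 := tendsto_nhds_unique (h1.congr (f₂ := fun _ => (0 : ℂ)) fun n => by
      simp only [Function.comp_apply, Pi.smul_apply, smul_eq_mul]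
      linear_combination c n * hxy (φ n)) tendsto_const_nhds
    simp only [Pi.smul_apply, smul_eq_mul] at h2
    linear_combination h2
  -- If `w` lies in the kernel of `v`, the inverses attract to `p`; otherwise `u` represents `p`.
  rcases mul_eq_zero.1 hcross with h | h
  · refine ⟨fun ν => (g (φ ν))⁻¹, perp v, perp u, perp_ne_zero hv, fun ν => Γ.inv_mem (hgΓ _),
      fun m n hmn => hφ.injective (hinj (inv_injective hmn)), perp_ne_zero hu, hatt.inv,
      (projMk_eq_iff _ hw).2 ?_⟩
    simp [dotProduct, perp, Fin.sum_univ_succ] at h ⊢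
    linear_combination h
  · exact ⟨g ∘ φ, u, v, hu, fun ν => hgΓ _, hinj.comp hφ.injective, hv, hatt,
      (projMk_eq_iff hu hw).2 h⟩

/-! ### Limits in the image of `cubicRep` -/

/-- The lift of `cubicRep` to `SL₂(ℂ) → GL₄(ℂ)`. -/
def cubicGL (g : SpecialLinearGroup (Fin 2) ℂ) : GL (Fin 4) ℂ :=
  Units.map cubicHom (SpecialLinearGroup.toGL g)

/-- The lift of `ρ ∘ cubicRep` to `SL₂(ℂ) → GL₆(ℂ)`. -/
def minorsGL (g : SpecialLinearGroup (Fin 2) ℂ) : GL (Set.powersetCard (Fin 4) 2) ℂ :=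
  Units.map (minorsHom 4 2) (cubicGL g)

theorem coe_cubicGL (g : SpecialLinearGroup (Fin 2) ℂ) :
    (cubicGL g : Matrix (Fin 4) (Fin 4) ℂ) = cubicMatrix g := rfl

theorem coe_minorsGL (g : SpecialLinearGroup (Fin 2) ℂ) :
    (minorsGL g : Matrix (Set.powersetCard (Fin 4) 2) (Set.powersetCard (Fin 4) 2) ℂ) =
      reducedMinors g := by
  have h : (g : Matrix (Fin 2) (Fin 2) ℂ).det = 1 := g.2
  calc _ = minors 4 2 (cubicMatrix g) := rfl
    _ = _ := by rw [minors_cubicMatrix, h, one_smul]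

theorem mk_cubicGL (g : SpecialLinearGroup (Fin 2) ℂ) :
    ProjGenLinGroup.mk (cubicGL g) = cubicRep (g : ProjectiveSpecialLinearGroup (Fin 2) ℂ) := rfl

theorem mk_minorsGL (g : SpecialLinearGroup (Fin 2) ℂ) : ProjGenLinGroup.mk (minorsGL g) =
    rho 4 2 (cubicRep (g : ProjectiveSpecialLinearGroup (Fin 2) ℂ)) := rfl

theorem Attracts.tendsto_cubicGL {g : ℕ → SpecialLinearGroup (Fin 2) ℂ} {u v : Fin 2 → ℂ}
    (h : Attracts g u v) : ∃ c : ℕ → ℂ, (∀ ν, c ν ≠ 0) ∧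
      Tendsto (fun ν => c ν • (cubicGL (g ν) : Matrix (Fin 4) (Fin 4) ℂ)) atTop
        (𝓝 (cubicMatrix (vecMulVec u v))) := by
  obtain ⟨c, hc, hlim⟩ := h
  refine ⟨fun ν => c ν ^ 3, fun ν => pow_ne_zero 3 (hc ν), ?_⟩
  refine ((continuous_cubicMatrix.tendsto _).comp hlim).congr fun ν => ?_
  rw [coe_cubicGL]
  exact cubicMatrix_smul _ _

/-- The scalars are `c ν ^ 4`, although the minors have degree six: on `SL₂` the factor `det g = 1`
has been dropped. This keeps the limit nonzero. -/
theorem Attracts.tendsto_minorsGL {g : ℕ → SpecialLinearGroup (Fin 2) ℂ} {u v : Fin 2 → ℂ}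
    (h : Attracts g u v) : ∃ c : ℕ → ℂ, (∀ ν, c ν ≠ 0) ∧
      Tendsto (fun ν => c ν • (minorsGL (g ν) :
        Matrix (Set.powersetCard (Fin 4) 2) (Set.powersetCard (Fin 4) 2) ℂ)) atTop
        (𝓝 (reducedMinors (vecMulVec u v))) := by
  obtain ⟨c, hc, hlim⟩ := h
  have hcont : Continuous reducedMinors := continuous_quarticMatrix.matrix_submatrix _ _
  refine ⟨fun ν => c ν ^ 4, fun ν => pow_ne_zero 4 (hc ν), ?_⟩
  refine ((hcont.tendsto _).comp hlim).congr fun ν => ?_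
  simp only [coe_minorsGL, Function.comp_apply, reducedMinors, quarticMatrix_smul]
  rfl

/-- Normality of `ρ ∘ σ` includes distinctness of its terms. If the quartic matrix is scalar, its
corner entries force `b = c = 0`, and comparing `a⁴` with `a³ d` gives `a = d`. -/
theorem rho_comp_cubicRep_injective :
    Function.Injective fun γ : ProjectiveSpecialLinearGroup (Fin 2) ℂ => rho 4 2 (cubicRep γ) := by
  refine (injective_iff_map_eq_one ((rho 4 2).comp cubicRep)).2 fun γ hγ => ?_
  obtain ⟨g, rfl⟩ := QuotientGroup.mk_surjective γ
  refine (QuotientGroup.eq_one_iff g).2 ?_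
  have h1 : ProjGenLinGroup.mk (1 : GL (Set.powersetCard (Fin 4) 2) ℂ) =
    ProjGenLinGroup.mk (minorsGL g) := hγ.symm
  obtain ⟨c, hc⟩ := pglMk_eq_iff.1 h1
  rw [coe_minorsGL] at hc
  obtain ⟨K, hK0, hK1⟩ := exists_enum_eq (i := 0) (j := 1) (by decide)
  obtain ⟨L, hL0, hL1⟩ := exists_enum_eq (i := 0) (j := 2) (by decide)
  obtain ⟨M, hM0, hM1⟩ := exists_enum_eq (i := 2) (j := 3) (by decide)
  have hKM : K ≠ M := by
    rintro rfl
    exact absurd (hK0.symm.trans hM0) (by decide)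
  have eKK := congrFun (congrFun hc K) K
  have eLL := congrFun (congrFun hc L) L
  have eKM := congrFun (congrFun hc K) M
  have eMK := congrFun (congrFun hc M) K
  simp [reducedMinors, subsetIndex, hK0, hK1, hL0, hL1, hM0, hM1, hKM, hKM.symm, pairIndex,
    quarticMatrix] at eKK eLL eKM eMK
  have hdet : (g : Matrix (Fin 2) (Fin 2) ℂ).det = 1 := g.2
  rw [det_fin_two, eKM, zero_mul, sub_zero] at hdet
  rw [eKM, mul_zero, zero_mul, add_zero, ← eKK] at eLL
  have ha : (g : Matrix (Fin 2) (Fin 2) ℂ) 0 0 ≠ 0 := left_ne_zero_of_mul_eq_one hdet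
  have had : (g : Matrix (Fin 2) (Fin 2) ℂ) 1 1 = (g : Matrix (Fin 2) (Fin 2) ℂ) 0 0 := by
    apply mul_left_cancel₀ (pow_ne_zero 3 ha)
    rw [eLL]
    ring
  refine Matrix.SpecialLinearGroup.mem_center_iff.2 ⟨(g : Matrix (Fin 2) (Fin 2) ℂ) 0 0, ?_, ?_⟩
  · rw [had] at hdet
    simpa [sq] using hdet
  · ext i j
    fin_cases i <;> fin_cases j <;> simp [eKM, eMK, had]

theorem cubicRep_injective : Function.Injective cubicRep := fun _ _ h =>
  rho_comp_cubicRep_injective (congrArg (rho 4 2) h)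

theorem Attracts.isLimitPlane {Γ : Subgroup (ProjectiveSpecialLinearGroup (Fin 2) ℂ)}
    {g : ℕ → SpecialLinearGroup (Fin 2) ℂ} {u v : Fin 2 → ℂ} (h : Attracts g u v)
    (hg : ∀ ν, (g ν : ProjectiveSpecialLinearGroup (Fin 2) ℂ) ∈ Γ)
    (hinj : Function.Injective fun ν => (g ν : ProjectiveSpecialLinearGroup (Fin 2) ℂ))
    (hu : u ≠ 0) (hv : v ≠ 0) :
    IsLimitPlane 2 (Γ.map cubicRep) (tangentLine (Projectivization.mk ℂ u hu)) := by
  obtain ⟨c, hc, hlim⟩ := h.tendsto_cubicGL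
  obtain ⟨c', hc', hlim'⟩ := h.tendsto_minorsGL
  obtain ⟨e, -, he⟩ := isLimitMatrix_of_tendsto (fun ν => mk_cubicGL (g ν)) hc hlim
    (cubicMatrix_vecMulVec_ne_zero hu hv)
  obtain ⟨e', he0, he'⟩ := isLimitMatrix_of_tendsto (fun ν => mk_minorsGL (g ν)) hc' hlim'
    (reducedMinors_vecMulVec_ne_zero hu hv)
  refine ⟨fun ν => cubicRep (g ν : ProjectiveSpecialLinearGroup (Fin 2) ℂ),
    fun ν => Subgroup.mem_map_of_mem _ (hg ν), ⟨cubicRep_injective.comp hinj, _, he⟩,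
    ⟨rho_comp_cubicRep_injective.comp hinj, _, he'⟩, plucker (tangentBasis u),
    ⟨tangentBasis u, linearIndependent_tangentBasis hu, ?_, rfl⟩, _, he', ?_⟩
  · rw [tangentLine_eq_span]
    congr 1
    exact (Matrix.range_cons_cons_empty (tangentBasis u 0) (tangentBasis u 1) ![])
  · obtain ⟨J, hJ⟩ := exists_cotangentPlucker_ne_zero hv
    -- The scalar cancels `e'` and the nonzero `J`-th cotangent coordinate; the `3` is the one in
    -- `plucker_tangentBasis`.
    refine ⟨Pi.single J (3 * (e' * cotangentPlucker v (subsetIndex J))⁻¹), ?_⟩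
    ext K
    rw [plucker_tangentBasis]
    simp [reducedMinors, quarticMatrix_vecMulVec, vecMulVec_apply]
    field_simp

theorem IsLimitMatrix.comp {ι : Type} [Fintype ι] [DecidableEq ι]
    {σ : ℕ → ProjGenLinGroup ι ℂ} {S : Matrix ι ι ℂ} (h : IsLimitMatrix σ S) {φ : ℕ → ℕ}
    (hφ : Tendsto φ atTop atTop) : IsLimitMatrix (σ ∘ φ) S := by
  obtain ⟨A, hA, hn, hlim⟩ := h
  exact ⟨A ∘ φ, fun ν => hA _, fun ν => hn _, hlim.comp hφ⟩

/-- A limit matrix of `ρ ∘ σ` is unchanged along a subsequence, so it is a multiple of the rank one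
limit. Its image contains no Plücker point other than that of the tangent line at the attracting
point. -/
theorem exists_eq_tangentLine_of_isLimitPlane
    {Γ : Subgroup (ProjectiveSpecialLinearGroup (Fin 2) ℂ)} (hΓ : IsKleinian Γ)
    {ℓ : Submodule ℂ (Fin 4 → ℂ)} (hℓ : IsLimitPlane 2 (Γ.map cubicRep) ℓ) :
    ∃ p ∈ kleinianLimitSet Γ, ℓ = tangentLine p := by
  obtain ⟨σ, hσ, ⟨hinj, -⟩, -, w, ⟨x, hx, rfl, rfl⟩, S, hS, y, hy⟩ := hℓ
  choose γ hγ hγσ using hσ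
  choose g hg using fun n => QuotientGroup.mk_surjective (γ n)
  obtain rfl : (fun n => (g n : ProjectiveSpecialLinearGroup (Fin 2) ℂ)) = γ := funext hg
  obtain rfl := funext hγσ
  have hinj' : Function.Injective fun n => (g n : ProjectiveSpecialLinearGroup (Fin 2) ℂ) :=
    fun m n hmn => hinj (congrArg cubicRep hmn)
  obtain ⟨φ, hφ, u, v, hu, hv, h⟩ := exists_attracts hΓ hγ hinj'
  refine ⟨_, h.mem_kleinianLimitSet (fun ν => hγ _) (hinj'.comp hφ.injective) hu hv, ?_⟩
  obtain ⟨c, hc, hlim⟩ := h.tendsto_minorsGL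
  obtain ⟨A, hA, -, hAlim⟩ := hS.comp hφ.tendsto_atTop
  obtain ⟨e, rfl⟩ := exists_eq_smul_of_tendsto (fun ν => (hA ν).trans (mk_minorsGL (g (φ ν))).symm)
    hAlim hlim (reducedMinors_vecMulVec_ne_zero hu hv)
  have hspan : tangentLine (Projectivization.mk ℂ u hu) =
      Submodule.span ℂ (Set.range (tangentBasis u)) := by
    rw [tangentLine_eq_span, ← Matrix.range_cons_cons_empty _ _ ![]]
    rfl
  rw [hspan]
  refine span_eq_of_plucker_eq_smul hx (linearIndependent_tangentBasis hu)
    (c := e * ((fun J => cotangentPlucker v (subsetIndex J)) ⬝ᵥ y) / 3) ?_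
  rw [← hy]
  ext K
  rw [Pi.smul_apply, plucker_tangentBasis]
  have : reducedMinors (vecMulVec u v) = vecMulVec (fun K => tangentPlucker u (subsetIndex K))
      (fun J => cotangentPlucker v (subsetIndex J)) := by
    rw [reducedMinors, quarticMatrix_vecMulVec]
    rfl
  rw [this, mulVecLin_apply, smul_mulVec, vecMulVec_mulVec]
  simp
  ring

/-! ### The limit set, discreteness and type L -/

theorem limitSet_map_cubicRep {Γ : Subgroup (ProjectiveSpecialLinearGroup (Fin 2) ℂ)}
    (hΓ : IsKleinian Γ) :
    limitSet 2 (Γ.map cubicRep) = ⋃ p ∈ kleinianLimitSet Γ, support (tangentLine p) := by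
  ext x
  simp only [Set.mem_iUnion, exists_prop]
  constructor
  · rintro ⟨ℓ, hℓ, hx⟩
    obtain ⟨p, hp, rfl⟩ := exists_eq_tangentLine_of_isLimitPlane hΓ hℓ
    exact ⟨p, hp, hx⟩
  · rintro ⟨p, hp, hx⟩
    obtain ⟨g, u, v, hu, hg, hinj, hv, h, rfl⟩ := exists_attracts_of_mem_kleinianLimitSet hΓ hp
    exact ⟨_, h.isLimitPlane hg hinj hu hv, hx⟩

theorem discreteTopology_map_cubicRep {Γ : Subgroup (ProjectiveSpecialLinearGroup (Fin 2) ℂ)}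
    (hΓ : IsKleinian Γ) : DiscreteTopology (Γ.map cubicRep) := by
  refine discreteTopology_of_finite fun A => ?_
  by_contra! hc
  -- If local finiteness fails at `A`, shrinking neighbourhoods give distinct group elements with
  -- representatives tending to `A`. The rank one limit then makes `A` a multiple of a singular
  -- matrix.
  let V : ℕ → Set (GL (Fin 4) ℂ) := fun n => {B | ∀ i j,
    (B : Matrix (Fin 4) (Fin 4) ℂ) i j ∈ Metric.ball ((A : Matrix (Fin 4) (Fin 4) ℂ) i j)
      (1 / ((n : ℝ) + 1))}
  have hV : Antitone V := fun m n hmn B hB i j =>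
    Metric.ball_subset_ball (Nat.one_div_le_one_div hmn) (hB i j)
  have hVA : ∀ n, V n ∈ 𝓝 A := by
    intro n
    refine eventually_all.2 fun i => eventually_all.2 fun j => ?_
    have hcont : Continuous fun B : GL (Fin 4) ℂ => (B : Matrix (Fin 4) (Fin 4) ℂ) i j :=
      (Units.continuous_val (M := Matrix (Fin 4) (Fin 4) ℂ)).matrix_elem i j
    exact hcont.continuousAt (Metric.ball_mem_nhds _ Nat.one_div_pos_of_nat)
  obtain ⟨σ, hinj, hσ⟩ := exists_injective_forall_mem
    (s := fun n => {σ | σ ∈ Γ.map cubicRep ∧ ∃ B ∈ V n, ProjGenLinGroup.mk B = σ})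
    (fun m n hmn σ ⟨h1, B, hB, h2⟩ => ⟨h1, B, hV hmn hB, h2⟩) (fun n => hc _ (hVA n))
  choose hσΓ B hB hBσ using hσ
  choose γ hγ hγσ using hσΓ
  choose g hg using fun n => QuotientGroup.mk_surjective (γ n)
  obtain rfl : (fun n => (g n : ProjectiveSpecialLinearGroup (Fin 2) ℂ)) = γ := funext hg
  obtain rfl := funext hγσ
  obtain ⟨φ, hφ, u, v, hu, hv, h⟩ := exists_attracts hΓ hγ
    fun m n hmn => hinj (congrArg cubicRep hmn)
  obtain ⟨c, hc, hlim⟩ := h.tendsto_cubicGL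
  have hBlim : Tendsto (fun n => (B n : Matrix (Fin 4) (Fin 4) ℂ)) atTop (𝓝 A) := by
    refine tendsto_pi_nhds.2 fun i => tendsto_pi_nhds.2 fun j => ?_
    rw [tendsto_iff_dist_tendsto_zero]
    exact squeeze_zero (fun _ => dist_nonneg) (fun n => (hB n i j).le)
      tendsto_one_div_add_atTop_nhds_zero_nat
  obtain ⟨e, he⟩ := exists_eq_smul_of_tendsto
    (fun ν => (hBσ (φ ν)).trans (mk_cubicGL (g (φ ν))).symm) (hBlim.comp hφ.tendsto_atTop) hlim
    (cubicMatrix_vecMulVec_ne_zero hu hv)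
  apply A.det_ne_zero
  rw [he, det_smul, det_cubicMatrix_vecMulVec u hv, mul_zero]

theorem isTypeL_map_cubicRep {Γ : Subgroup (ProjectiveSpecialLinearGroup (Fin 2) ℂ)}
    (hΓ : IsKleinian Γ) : IsTypeL 2 (Γ.map cubicRep) := by
  refine ⟨discreteTopology_map_cubicRep hΓ, ?_⟩
  rw [limitSet_map_cubicRep hΓ]
  obtain ⟨q, hq⟩ := id hΓ
  set K := ⋃ p ∈ kleinianLimitSet Γ, support (tangentLine p) with hK
  have hKo : IsOpen Kᶜ :=
    (isClosed_biUnion_support_tangentLine (isClosed_kleinianLimitSet Γ)).isOpen_compl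
  have hqK : support (tangentLine q) ⊆ Kᶜ := by
    refine Set.subset_compl_iff_disjoint_right.2 ?_
    simp only [hK, Set.disjoint_iUnion_right]
    exact fun p hp => disjoint_support_tangentLine fun h => hp (h ▸ hq)
  have hconn := isConnected_support_tangentLine q
  obtain ⟨x, hx⟩ := hconn.nonempty
  have := locallyConnectedSpace_projectivization 4
  -- The large domain is the component of the complement that contains the tangent line at a point
  -- of discontinuity.
  exact ⟨connectedComponentIn Kᶜ x, ⟨hKo.connectedComponentIn,
    isConnected_connectedComponentIn_iff.2 (hqK hx), tangentLine q, finrank_tangentLine q,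
    hconn.isPreconnected.subset_connectedComponentIn hx hqK⟩, connectedComponentIn_subset _ _⟩

end TypeL

end

theorem theorem6p2
    (Γ : Subgroup (Matrix.ProjectiveSpecialLinearGroup (Fin 2) ℂ))
    (hΓ : TypeL.IsKleinian Γ) :
    TypeL.IsTypeL 2 (Γ.map TypeL.cubicRep) ∧
      TypeL.limitSet 2 (Γ.map TypeL.cubicRep) =
        ⋃ p ∈ TypeL.kleinianLimitSet Γ, TypeL.support (TypeL.tangentLine p) :=
  ⟨TypeL.isTypeL_map_cubicRep hΓ, TypeL.limitSet_map_cubicRep hΓ⟩
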